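/- Let $f_0:[0,1]\to\mathbb R$ satisfy $f_0(r)=\tilde f_0(r^2)$ with $\tilde f_0\in\mathscr C^{2,\beta}([0,1])$ for some $\beta\in(0,1)$, $\inf_{r\in(0,1]}\frac{f_0'(r)}{r}>0$, and $f_0<0$ on $[0,1]$. Put $$\kappa_1=\inf_{r\in[0,1]}\int_0^1 s f_0(rs)\,ds,\qquad \kappa_2=\sup_{r\in[0,1]}\int_0^1 s f_0(rs)\,ds,$$ $$\widehat\Omega_n=\int_0^1 s f_0(s)\,ds-\frac{n+1}{n}\int_0^1 s^{2n+1}f_0(s)\,ds\qquad(n\ge1).$$ For $\Omega\in\mathbb R\setminus[\kappa_1,\kappa_2]$ let $\sigma_\Omega=-1$ if $\Omega<\kappa_1$, $\sigma_\Omega=1$ if $\Omega>\kappa_2$, and $$\nu_\Omega(r)=\sigma_\Omega\,\frac{f_0'(r)}{r\left(\Omega-\int_0^1 s f_0(sr)\,ds\right)}\qquad (r\in(0,1]).$$ For $n\ge1$ let $F_{n,\Omega}$ be the unique solution of class $\mathscr C^2$ on $[0,1]$ of $$F''+\frac{2n+1}{r}F'+\sigma_\Omega\nu_\Omega F=0\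 \text{ on }(0,1),\qquad F(0)=1,$$ and set $$\zeta_n(\Omega)=F_{n,\Omega}(1)\left(\Omega-\frac{n}{n+1}\int_0^1 s f_0(s)\,ds\right)+\int_0^1F_{n,\Omega}(s)\,s^{2n+1}\big(f_0(s)-2\Omega\big)\,ds.$$ Let $\alpha\in(1,2)$. Then there is an integer $m_0\ge1$, depending only on $f_0$ and $\alpha$, such that for every integer $m\ge m_0$ there exists $$\Omega_m\in(\widehat\Omega_m-m^{-\alpha},\widehat\Omega_m)$$ with $\Omega_m>\kappa_2$ (for this $\Omega_m$ and all $n\ge1$, the solution $F_{nm,\Omega_m}$ exists and is unique, so that $\zeta_{nm}(\Omega_m)$ is defined) such that 1. $\zeta_m(\Omega_m)=0$; 2. $\Omega_m\neq\widehat\Omega_{nm}$ for all $n\ge1$; 3. $\zeta_{nm}(\Omega_m)\neq0$ for all $n\ge2$. -/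

import Mathlib

namespace RotatingVortex

open Set

noncomputable section

/-- `g` belongs to the Hölder space `C^{2,β}([0,1])` (one-sided derivatives at the end points). -/
def IsC2Holder (β : NNReal) (g : ℝ → ℝ) : Prop :=
  ContDiffOn ℝ 2 g (Icc 0 1) ∧
    ∃ C : NNReal, HolderOnWith C β (iteratedDerivWithin 2 g (Icc 0 1)) (Icc 0 1)

/-- The standing assumptions on the radial profile `f₀ : [0,1] → ℝ` (a function on `ℝ` of which only
the values on `[0,1]` matter): `f₀(r) = g(r²)` with `g ∈ C^{2,β}([0,1])` for some `β ∈ (0,1)`, and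
`inf_{r ∈ (0,1]} f₀'(r) / r > 0`. -/
structure IsProfile (f₀ : ℝ → ℝ) : Prop where
  regular : ∃ (β : NNReal) (g : ℝ → ℝ), 0 < β ∧ β < 1 ∧ IsC2Holder β g ∧
    ∀ r ∈ Icc (0 : ℝ) 1, f₀ r = g (r ^ 2)
  increasing : ∃ c : ℝ, 0 < c ∧ ∀ r ∈ Ioc (0 : ℝ) 1, c ≤ derivWithin f₀ (Icc 0 1) r / r

/-- `κ₁ = inf_{r ∈ [0,1]} ∫₀¹ s f₀(rs) ds`. -/
def kappa₁ (f₀ : ℝ → ℝ) : ℝ := ⨅ r : Icc (0 : ℝ) 1, ∫ s in (0 : ℝ)..1, s * f₀ (r * s)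

/-- `κ₂ = sup_{r ∈ [0,1]} ∫₀¹ s f₀(rs) ds`. -/
def kappa₂ (f₀ : ℝ → ℝ) : ℝ := ⨆ r : Icc (0 : ℝ) 1, ∫ s in (0 : ℝ)..1, s * f₀ (r * s)

/-- `μ⁰_Ω(r) = f₀'(r) / (r (Ω - ∫₀¹ s f₀(sr) ds))` for `r ∈ (0,1]`. -/
def mu0 (f₀ : ℝ → ℝ) (Ω r : ℝ) : ℝ :=
  derivWithin f₀ (Icc 0 1) r / (r * (Ω - ∫ s in (0 : ℝ)..1, s * f₀ (s * r)))

/-- The sign `σ_Ω`: `-1` for `Ω < κ₁`, `1` for `Ω > κ₂` (and the placeholder `0` on `[κ₁, κ₂]`, which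
is outside its domain). -/
def sigma (f₀ : ℝ → ℝ) (Ω : ℝ) : ℝ :=
  if Ω < kappa₁ f₀ then -1 else if kappa₂ f₀ < Ω then 1 else 0

/-- The potential `ν_Ω = σ_Ω μ⁰_Ω`. -/
def nu (f₀ : ℝ → ℝ) (Ω r : ℝ) : ℝ := sigma f₀ Ω * mu0 f₀ Ω r

/-- `F` is a solution of class `C²` on `[0,1]` of the normalized Sturm–Liouville problem
`F'' + (2n+1)/r F' + σ_Ω ν_Ω(r) F = 0` on `(0,1)`, `F(0) = 1`. -/
def IsSturmLiouvilleSol (f₀ : ℝ → ℝ) (n : ℕ) (Ω : ℝ) (F : ℝ → ℝ) : Prop :=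
  ContDiffOn ℝ 2 F (Icc 0 1) ∧ F 0 = 1 ∧
    ∀ r ∈ Ioo (0 : ℝ) 1,
      iteratedDerivWithin 2 F (Icc 0 1) r
        + (2 * (n : ℝ) + 1) / r * derivWithin F (Icc 0 1) r
        + sigma f₀ Ω * nu f₀ Ω r * F r = 0

/-- The problem above has a solution, and any two solutions agree on `[0,1]`. -/
def HasUniqueSturmLiouvilleSol (f₀ : ℝ → ℝ) (n : ℕ) (Ω : ℝ) : Prop :=
  ∃ F, IsSturmLiouvilleSol f₀ n Ω F ∧
    ∀ G, IsSturmLiouvilleSol f₀ n Ω G → EqOn G F (Icc 0 1)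

/-- `F_{n,Ω}`: the `C²` solution on `[0,1]` of the normalized Sturm–Liouville problem. -/
def slSol (f₀ : ℝ → ℝ) (n : ℕ) (Ω : ℝ) : ℝ → ℝ :=
  Classical.epsilon (IsSturmLiouvilleSol f₀ n Ω)

/-- The dispersion function `ζ_n(Ω)`. -/
def zeta (f₀ : ℝ → ℝ) (n : ℕ) (Ω : ℝ) : ℝ :=
  slSol f₀ n Ω 1 * (Ω - (n : ℝ) / (n + 1) * ∫ s in (0 : ℝ)..1, s * f₀ s)
    + ∫ s in (0 : ℝ)..1, slSol f₀ n Ω s * s ^ (2 * n + 1) * (f₀ s - 2 * Ω)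

/-- `Ω̂_n = ∫₀¹ s f₀(s) ds - (n+1)/n ∫₀¹ s^{2n+1} f₀(s) ds`, for `n ≥ 1`. -/
def omegaHat (f₀ : ℝ → ℝ) (n : ℕ) : ℝ :=
  (∫ s in (0 : ℝ)..1, s * f₀ s)
    - ((n : ℝ) + 1) / n * ∫ s in (0 : ℝ)..1, s ^ (2 * n + 1) * f₀ s

end

end RotatingVortex

namespace RotatingVortex

open Set

noncomputable section

/-! Write `M` for the potential. Since the profile increases, `κ₂` is `mean f 1`, and for `Ω > κ₂`
the potential is positive. The singular ODE is then equivalent to the Volterra equation `F = 1 - pot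
n (M F)`. The operator on the right has norm at most `pot n M 1 ≤ (1/2n) ∫ s M`. If `Ω` stays at
distance of order `1/m` above `κ₂`, that integral is only `O(log m)` (`integral_mul_potential_le`).
Hence for every degree `N ≥ m` the solution exists, is unique, and equals `1 + O(log m / m)`.

Writing `F(s) = F(1) + (F(s) - F(1))` turns the dispersion function into `F(1) n/(n+1) (Ω - Ω̂_n)`
plus a correction `∫ (F - F(1)) s^{2n+1} (f - 2Ω)` (`dispersion_eq`). The correction is `O(log m /
m²)`, which is negligible against `m^{-α}` because `α < 2`. So `ζ_m < 0` at `Ω̂_m - m^{-α}`. At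
`Ω̂_m` the main term vanishes and the correction is positive (`le_integral`): `F` decreases, and
near `s = 1`, where the weight concentrates, `f - 2Ω` is close to `f(1) - 2κ₂ > 0`. The intermediate
value theorem gives the root.

Negativity of `f₀` enters through `Ω̂_n - κ₂ ≈ -f(1)/(2n)` (`omegaHat_sub`). As `α > 1`, the root
lies above `κ₂`, and above each `Ω̂_{nm}` with `n ≥ 2` by at least `-f(1)/(8m)`. There the main term
of `ζ_{nm}` dominates its correction. -/

/-! ### Inverting the radial operator `W'' + (2n+1)/r W'`. -/

/-- The weighted average `∫₀¹ u^{2n+1} h(ru) du`. -/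
def avg (n : ℕ) (h : ℝ → ℝ) (r : ℝ) : ℝ := ∫ u in (0 : ℝ)..1, u ^ (2 * n + 1) * h (r * u)

/-- The solution operator of `W'' + (2n+1)/r W' = h`, `W(0) = 0`. -/
def pot (n : ℕ) (h : ℝ → ℝ) (r : ℝ) : ℝ := ∫ t in (0 : ℝ)..r, t * avg n h t

theorem continuous_avg {n : ℕ} {h : ℝ → ℝ} (hh : Continuous h) : Continuous (avg n h) := by
  unfold avg
  apply intervalIntegral.continuous_parametric_intervalIntegral_of_continuous'
  fun_prop

theorem pow_mul_avg (n : ℕ) (h : ℝ → ℝ) (r : ℝ) :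
    r ^ (2 * n + 2) * avg n h r = ∫ s in (0 : ℝ)..r, s ^ (2 * n + 1) * h s := by
  have := intervalIntegral.mul_integral_comp_mul_left (a := 0) (b := 1)
    (f := fun s => s ^ (2 * n + 1) * h s) (c := r)
  simp only [mul_zero, mul_one] at this
  rw [← this, avg, ← intervalIntegral.integral_const_mul, ← intervalIntegral.integral_const_mul]
  congr 1
  ext u
  ring

theorem avg_zero (n : ℕ) (h : ℝ → ℝ) : avg n h 0 = h 0 / (2 * n + 2) := by
  simp only [avg, zero_mul, intervalIntegral.integral_mul_const, integral_pow]
  push_cast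
  simp
  ring

theorem hasDerivAt_pot {n : ℕ} {h : ℝ → ℝ} (hh : Continuous h) (r : ℝ) :
    HasDerivAt (pot n h) (r * avg n h r) r := by
  have hc : Continuous fun t => t * avg n h t := continuous_id.mul (continuous_avg hh)
  exact intervalIntegral.integral_hasDerivAt_right (hc.intervalIntegrable _ _)
    hc.stronglyMeasurable.stronglyMeasurableAtFilter hc.continuousAt

theorem hasDerivAt_pow_mul_avg {n : ℕ} {h : ℝ → ℝ} (hh : Continuous h) (r : ℝ) :
    HasDerivAt (fun r => r ^ (2 * n + 2) * avg n h r) (r ^ (2 * n + 1) * h r) r := by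
  have hc : Continuous fun s => s ^ (2 * n + 1) * h s := by fun_prop
  rw [funext (pow_mul_avg n h)]
  exact intervalIntegral.integral_hasDerivAt_right (hc.intervalIntegrable _ _)
    hc.stronglyMeasurable.stronglyMeasurableAtFilter hc.continuousAt

/-- Away from the origin this is the quotient rule applied to `r^{2n+2} avg / r^{2n+1}`. At `0` the
difference quotient is `avg` itself, and `avg n h 0 = h 0 / (2n+2)` makes the two formulas agree, so
no singularity remains. -/
theorem hasDerivAt_mul_avg {n : ℕ} {h : ℝ → ℝ} (hh : Continuous h) (r : ℝ) :
    HasDerivAt (fun r => r * avg n h r) (h r - (2 * n + 1) * avg n h r) r := by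
  rcases eq_or_ne r 0 with rfl | hr
  · have h1 : h 0 - (2 * n + 1) * avg n h 0 = avg n h 0 := by
      rw [avg_zero]
      have : (2 * (n : ℝ) + 2) ≠ 0 := by positivity
      field_simp
      ring
    rw [h1, hasDerivAt_iff_tendsto_slope]
    have h2 := ((continuous_avg hh (n := n)).tendsto 0).mono_left
      (nhdsWithin_le_nhds (s := ({0} : Set ℝ)ᶜ))
    refine h2.congr' ?_
    filter_upwards [self_mem_nhdsWithin] with x hx
    simp only [mem_compl_iff, mem_singleton_iff] at hx
    simp [slope_def_field, hx]
  · have h1 := (hasDerivAt_pow_mul_avg hh (n := n) r).div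
      (hasDerivAt_pow (2 * n + 1) r) (pow_ne_zero _ hr)
    have h2 : (fun r => r * avg n h r) =ᶠ[nhds r]
        (fun r => r ^ (2 * n + 2) * avg n h r) / fun r => r ^ (2 * n + 1) := by
      filter_upwards [isOpen_ne.mem_nhds hr] with x hx
      have hx' : x ≠ 0 := hx
      simp only [Pi.div_apply]
      field_simp
      ring
    refine (h1.congr_of_eventuallyEq h2).congr_deriv ?_
    push_cast
    field_simp
    ring

theorem contDiff_pot {n : ℕ} {h : ℝ → ℝ} (hh : Continuous h) : ContDiff ℝ 2 (pot n h) := by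
  have h1 : deriv (pot n h) = fun r => r * avg n h r := funext fun r => (hasDerivAt_pot hh r).deriv
  have h2 : deriv (fun r => r * avg n h r) = fun r => h r - (2 * n + 1) * avg n h r :=
    funext fun r => (hasDerivAt_mul_avg hh r).deriv
  have h3 : ContDiff ℝ 1 (fun r => r * avg n h r) := by
    rw [contDiff_one_iff_deriv, h2]
    exact ⟨fun r => (hasDerivAt_mul_avg hh r).differentiableAt,
      hh.sub (continuous_const.mul (continuous_avg hh))⟩
  have : (2 : WithTop ℕ∞) = 1 + 1 := by norm_num
  rw [this, contDiff_succ_iff_deriv, h1]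
  exact ⟨fun r => (hasDerivAt_pot hh r).differentiableAt, by simp, h3⟩

theorem avg_mono {n : ℕ} {h k : ℝ → ℝ} (hh : Continuous h) (hk : Continuous k)
    (hle : ∀ r ∈ Icc (0 : ℝ) 1, h r ≤ k r) {r : ℝ} (hr : r ∈ Icc (0 : ℝ) 1) :
    avg n h r ≤ avg n k r := by
  refine intervalIntegral.integral_mono_on zero_le_one
    (Continuous.intervalIntegrable (by fun_prop) _ _)
    (Continuous.intervalIntegrable (by fun_prop) _ _) fun u hu => ?_
  exact mul_le_mul_of_nonneg_left
    (hle _ ⟨mul_nonneg hr.1 hu.1, mul_le_one₀ hr.2 hu.1 hu.2⟩) (pow_nonneg hu.1 _)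

theorem avg_const (n : ℕ) (a r : ℝ) : avg n (fun _ => a) r = a / (2 * n + 2) := by
  simp only [avg, intervalIntegral.integral_mul_const, integral_pow]
  push_cast
  simp
  ring

theorem pot_const (n : ℕ) (a r : ℝ) : pot n (fun _ => a) r = a / (2 * n + 2) * (r ^ 2 / 2) := by
  simp only [pot, avg_const, intervalIntegral.integral_mul_const, integral_id]
  ring

theorem pot_zero (n : ℕ) (h : ℝ → ℝ) : pot n h 0 = 0 := by simp [pot]

/-- Increments of the potential are monotone in the source. -/
theorem pot_sub_le {n : ℕ} {h k : ℝ → ℝ} (hh : Continuous h) (hk : Continuous k)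
    (hle : ∀ r ∈ Icc (0 : ℝ) 1, h r ≤ k r) {r t : ℝ} (hr : 0 ≤ r) (hrt : r ≤ t) (ht : t ≤ 1) :
    pot n h t - pot n h r ≤ pot n k t - pot n k r := by
  have ch := continuous_avg hh (n := n)
  have ck := continuous_avg hk (n := n)
  have ch' : Continuous fun t => t * avg n h t := by fun_prop
  have ck' : Continuous fun t => t * avg n k t := by fun_prop
  simp only [pot]
  rw [intervalIntegral.integral_interval_sub_left (ch'.intervalIntegrable _ _)
      (ch'.intervalIntegrable _ _),
    intervalIntegral.integral_interval_sub_left (ck'.intervalIntegrable _ _)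
      (ck'.intervalIntegrable _ _)]
  refine intervalIntegral.integral_mono_on hrt (ch'.intervalIntegrable _ _)
    (ck'.intervalIntegrable _ _) fun u hu => ?_
  have hu0 : 0 ≤ u := hr.trans hu.1
  exact mul_le_mul_of_nonneg_left (avg_mono hh hk hle ⟨hu0, hu.2.trans ht⟩) hu0

theorem pot_mono {n : ℕ} {h k : ℝ → ℝ} (hh : Continuous h) (hk : Continuous k)
    (hle : ∀ r ∈ Icc (0 : ℝ) 1, h r ≤ k r) {r : ℝ} (hr : r ∈ Icc (0 : ℝ) 1) :
    pot n h r ≤ pot n k r := by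
  simpa [pot_zero] using pot_sub_le (n := n) hh hk hle le_rfl hr.1 hr.2

theorem pot_monotoneOn {n : ℕ} {h : ℝ → ℝ} (hh : Continuous h)
    (hpos : ∀ r ∈ Icc (0 : ℝ) 1, 0 ≤ h r) {r t : ℝ} (hr : 0 ≤ r) (hrt : r ≤ t) (ht : t ≤ 1) :
    pot n h r ≤ pot n h t := by
  have := pot_sub_le (n := n) continuous_const hh hpos hr hrt ht
  simp only [pot_const, zero_div, zero_mul] at this
  linarith

theorem avg_smul (n : ℕ) (a : ℝ) (h : ℝ → ℝ) (r : ℝ) :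
    avg n (fun x => a * h x) r = a * avg n h r := by
  simp only [avg, ← intervalIntegral.integral_const_mul]
  congr 1
  ext u
  ring

theorem pot_smul (n : ℕ) (a : ℝ) (h : ℝ → ℝ) (r : ℝ) :
    pot n (fun x => a * h x) r = a * pot n h r := by
  simp only [pot, ← intervalIntegral.integral_const_mul, avg_smul]
  congr 1
  ext u
  ring

theorem avg_sub {n : ℕ} {h k : ℝ → ℝ} (hh : Continuous h) (hk : Continuous k) (r : ℝ) :
    avg n (fun x => h x - k x) r = avg n h r - avg n k r := by
  simp only [avg, mul_sub]
  exact intervalIntegral.integral_sub (Continuous.intervalIntegrable (by fun_prop) _ _)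
    (Continuous.intervalIntegrable (by fun_prop) _ _)

theorem pot_sub {n : ℕ} {h k : ℝ → ℝ} (hh : Continuous h) (hk : Continuous k) (r : ℝ) :
    pot n (fun x => h x - k x) r = pot n h r - pot n k r := by
  have ch := continuous_avg hh (n := n)
  have ck := continuous_avg hk (n := n)
  simp only [pot, mul_sub, avg_sub hh hk]
  exact intervalIntegral.integral_sub (Continuous.intervalIntegrable (by fun_prop) _ _)
    (Continuous.intervalIntegrable (by fun_prop) _ _)

/-- Positivity of `pot` makes `pot n M 1` a bound for the sup-norm of the operator `F ↦ pot n (M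
F)`; smallness of this one number drives all later estimates. -/
theorem abs_pot_mul_le {n : ℕ} {M F : ℝ → ℝ} {B : ℝ} (hM : Continuous M) (hF : Continuous F)
    (hM0 : ∀ r ∈ Icc (0 : ℝ) 1, 0 ≤ M r) (hB : ∀ r ∈ Icc (0 : ℝ) 1, |F r| ≤ B) {r : ℝ}
    (hr : r ∈ Icc (0 : ℝ) 1) : |pot n (fun x => M x * F x) r| ≤ B * pot n M 1 := by
  have hB0 : 0 ≤ B := (abs_nonneg _).trans (hB 0 (by simp))
  have h1 : pot n (fun x => M x * F x) r ≤ pot n (fun x => B * M x) r :=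
    pot_mono (by fun_prop) (by fun_prop) (fun x hx => by
      rw [mul_comm]; exact mul_le_mul_of_nonneg_right (abs_le.1 (hB x hx)).2 (hM0 x hx)) hr
  have h2 : pot n (fun x => (-B) * M x) r ≤ pot n (fun x => M x * F x) r :=
    pot_mono (by fun_prop) (by fun_prop) (fun x hx => by
      rw [mul_comm (M x)]; exact mul_le_mul_of_nonneg_right (abs_le.1 (hB x hx)).1 (hM0 x hx)) hr
  rw [pot_smul] at h1 h2
  have h3 := mul_le_mul_of_nonneg_left (pot_monotoneOn (n := n) hM hM0 hr.1 hr.2 le_rfl) hB0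
  rw [abs_le]
  constructor <;> linarith

/-- Integrating the derivative of `r² avg n h r` over `[0,1]` gives `∫ s h - 2n pot n h 1 = avg n h
1 ≥ 0`. This is the source of the decay in `n`. -/
theorem pot_one_le {n : ℕ} (hn : 1 ≤ n) {h : ℝ → ℝ} (hh : Continuous h)
    (hpos : ∀ r ∈ Icc (0 : ℝ) 1, 0 ≤ h r) :
    pot n h 1 ≤ (∫ s in (0 : ℝ)..1, s * h s) / (2 * n) := by
  have ch := continuous_avg hh (n := n)
  have hd : ∀ r : ℝ, HasDerivAt (fun r => r * (r * avg n h r))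
      (r * h r - 2 * n * (r * avg n h r)) r := fun r => by
    refine ((hasDerivAt_id r).mul (hasDerivAt_mul_avg hh r)).congr_deriv ?_
    simp only [id]
    ring
  have h1 := intervalIntegral.integral_eq_sub_of_hasDerivAt (a := 0) (b := 1)
    (fun r _ => hd r) (Continuous.intervalIntegrable (by fun_prop) _ _)
  rw [intervalIntegral.integral_sub (Continuous.intervalIntegrable (by fun_prop) _ _)
    (Continuous.intervalIntegrable (by fun_prop) _ _), intervalIntegral.integral_const_mul] at h1
  have h2 : 0 ≤ avg n h 1 := by
    have := avg_mono (n := n) (r := 1) continuous_const hh hpos (by simp)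
    rwa [avg_const, zero_div] at this
  have hn' : (0 : ℝ) < 2 * n := by positivity
  rw [le_div_iff₀ hn', pot]
  linarith

/-! ### The Volterra equation: stability, existence, closeness to `1`. -/

/-- `F` solves the integral form `F = 1 - pot n (M F)` of the Sturm–Liouville problem on `[0,1]`. -/
structure IsVolterraSol (n : ℕ) (M F : ℝ → ℝ) : Prop where
  cont : Continuous F
  eqn : ∀ r ∈ Icc (0 : ℝ) 1, F r = 1 - pot n (fun x => M x * F x) r

/-- Stability of the integral equation under perturbation of the potential. -/
theorem IsVolterraSol.abs_sub_le {n : ℕ} {M₁ M₂ F₁ F₂ : ℝ → ℝ} {δ B : ℝ}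
    (h₁ : IsVolterraSol n M₁ F₁) (h₂ : IsVolterraSol n M₂ F₂)
    (hM₁ : Continuous M₁) (hM₂ : Continuous M₂) (hM0 : ∀ r ∈ Icc (0 : ℝ) 1, 0 ≤ M₁ r)
    (hpot : pot n M₁ 1 ≤ 1 / 2) (hδ : ∀ r ∈ Icc (0 : ℝ) 1, |M₁ r - M₂ r| ≤ δ)
    (hB : ∀ r ∈ Icc (0 : ℝ) 1, |F₂ r| ≤ B) {r : ℝ} (hr : r ∈ Icc (0 : ℝ) 1) :
    |F₁ r - F₂ r| ≤ 2 * (B * δ) := by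
  have c₁ := h₁.cont
  have c₂ := h₂.cont
  have hB0 : 0 ≤ B := (abs_nonneg _).trans (hB 0 (by simp))
  have hδ0 : 0 ≤ δ := (abs_nonneg _).trans (hδ 0 (by simp))
  obtain ⟨x, hx, hmax⟩ := isCompact_Icc.exists_isMaxOn (nonempty_Icc.2 zero_le_one)
    (f := fun r => |F₁ r - F₂ r|) (s := Icc (0 : ℝ) 1) (by fun_prop)
  have hS : ∀ y ∈ Icc (0 : ℝ) 1, |F₁ y - F₂ y| ≤ |F₁ x - F₂ x| := fun y hy => hmax hy
  set S := |F₁ x - F₂ x| with hSdef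
  have e : F₂ x - F₁ x = pot n (fun x => M₁ x * (F₁ x - F₂ x)) x
      + pot n (fun x => (M₁ x - M₂ x) * F₂ x) x := by
    rw [h₁.eqn x hx, h₂.eqn x hx]
    have e1 := pot_sub (n := n) (h := fun x => M₁ x * F₁ x) (k := fun x => M₁ x * F₂ x)
      (by fun_prop) (by fun_prop) x
    have e2 := pot_sub (n := n) (h := fun x => M₁ x * F₂ x) (k := fun x => M₂ x * F₂ x)
      (by fun_prop) (by fun_prop) x
    simp only [mul_sub, sub_mul, e1, e2]
    ring
  have b1 := abs_pot_mul_le (n := n) (F := fun y => F₁ y - F₂ y) hM₁ (by fun_prop) hM0 hS hx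
  have b2 : |pot n (fun x => (M₁ x - M₂ x) * F₂ x) x| ≤ B * δ := by
    have := abs_pot_mul_le (n := n) (M := fun _ => 1) (F := fun x => (M₁ x - M₂ x) * F₂ x)
      (B := B * δ) continuous_const (by fun_prop) (fun _ _ => zero_le_one) (fun y hy => by
        rw [abs_mul, mul_comm]
        exact mul_le_mul (hB y hy) (hδ y hy) (abs_nonneg _) hB0) hx
    simp only [one_mul, pot_const] at this
    refine this.trans (mul_le_of_le_one_right (by positivity) ?_)
    have h2 : (1 : ℝ) / (2 * n + 2) ≤ 1 := by
      rw [div_le_one (by positivity)]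
      have : (0 : ℝ) ≤ n := n.cast_nonneg
      linarith
    linarith
  -- At a maximum point of the difference, the contraction factor `1/2` lets the first term be
  -- absorbed.
  have hS1 : S ≤ 1 / 2 * S + B * δ := by
    rw [hSdef, abs_sub_comm, e]
    refine (abs_add_le _ _).trans (add_le_add (b1.trans ?_) b2)
    rw [← e, abs_sub_comm, mul_comm]
    exact mul_le_mul_of_nonneg_right hpot (abs_nonneg _)
  have := hS r hr
  linarith

theorem IsVolterraSol.eqOn {n : ℕ} {M F₁ F₂ : ℝ → ℝ}
    (h₁ : IsVolterraSol n M F₁) (h₂ : IsVolterraSol n M F₂)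
    (hM : Continuous M) (hM0 : ∀ r ∈ Icc (0 : ℝ) 1, 0 ≤ M r)
    (hpot : pot n M 1 ≤ 1 / 2) : EqOn F₁ F₂ (Icc 0 1) := by
  intro r hr
  obtain ⟨B, hB⟩ := isCompact_Icc.exists_bound_of_continuousOn (s := Icc (0 : ℝ) 1)
    h₂.cont.continuousOn
  have := h₁.abs_sub_le h₂ hM hM hM0 hpot (δ := 0) (B := B) (by simp) hB hr
  rw [mul_zero, mul_zero] at this
  exact sub_eq_zero.1 (abs_nonpos_iff.1 this)

/-- Banach's fixed point theorem in `C([0,1])`, with contraction constant `1/2` from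
`abs_pot_mul_le`. -/
theorem exists_isVolterraSol {n : ℕ} {M : ℝ → ℝ} (hM : Continuous M)
    (hM0 : ∀ r ∈ Icc (0 : ℝ) 1, 0 ≤ M r) (hpot : pot n M 1 ≤ 1 / 2) :
    ∃ F, IsVolterraSol n M F := by
  have cext : ∀ F : C(Icc (0 : ℝ) 1, ℝ), Continuous (IccExtend (zero_le_one (α := ℝ)) F) :=
    fun F => F.continuous.Icc_extend'
  have cpot : ∀ h : ℝ → ℝ, Continuous h → Continuous (pot n h) :=
    fun h hh => (contDiff_pot hh).continuous
  let Φ : C(Icc (0 : ℝ) 1, ℝ) → C(Icc (0 : ℝ) 1, ℝ) := fun F =>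
    ⟨fun r => 1 - pot n (fun x => M x * IccExtend (zero_le_one (α := ℝ)) F x) r,
      continuous_const.sub ((cpot _ (hM.mul (cext F))).comp continuous_subtype_val)⟩
  have hΦ : ContractingWith (1 / 2) Φ := by
    refine ⟨by norm_num [← NNReal.coe_lt_coe], LipschitzWith.of_dist_le_mul fun F G => ?_⟩
    rw [ContinuousMap.dist_le (by positivity)]
    intro r
    have e := pot_sub (n := n) (h := fun x => M x * IccExtend (zero_le_one (α := ℝ)) G x)
      (k := fun x => M x * IccExtend (zero_le_one (α := ℝ)) F x) (hM.mul (cext G))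
      (hM.mul (cext F)) r
    have b := abs_pot_mul_le (n := n) (B := dist F G)
      (F := fun x => IccExtend (zero_le_one (α := ℝ)) G x - IccExtend (zero_le_one (α := ℝ)) F x)
      hM ((cext G).sub (cext F)) hM0 (fun x _ => by
        rw [← Real.dist_eq, dist_comm]
        exact ContinuousMap.dist_apply_le_dist _) r.2
    simp only [mul_sub, e] at b
    rw [Real.dist_eq]
    simp only [Φ, ContinuousMap.coe_mk]
    rw [sub_sub_sub_cancel_left]
    refine b.trans ?_
    rw [mul_comm]
    push_cast
    exact mul_le_mul_of_nonneg_right hpot dist_nonneg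
  set F := hΦ.fixedPoint with hF
  have hfix : Φ F = F := hΦ.fixedPoint_isFixedPt
  refine ⟨IccExtend (zero_le_one (α := ℝ)) F, cext F, fun r hr => ?_⟩
  rw [IccExtend_of_mem _ _ hr]
  conv_lhs => rw [← hfix]
  rfl

/-- The equation bounds `|F - 1|` by `sup |F|` times `pot n M 1`; since the latter is at most `1/2`,
`sup |F| ≤ 2` follows first. -/
theorem IsVolterraSol.abs_sub_one_le {n : ℕ} {M F : ℝ → ℝ} (h : IsVolterraSol n M F)
    (hM : Continuous M) (hM0 : ∀ r ∈ Icc (0 : ℝ) 1, 0 ≤ M r) (hpot : pot n M 1 ≤ 1 / 2)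
    {r : ℝ} (hr : r ∈ Icc (0 : ℝ) 1) : |F r - 1| ≤ 2 * pot n M 1 := by
  have c := h.cont
  obtain ⟨x, hx, hmax⟩ := isCompact_Icc.exists_isMaxOn (nonempty_Icc.2 zero_le_one)
    (f := fun r => |F r|) (s := Icc (0 : ℝ) 1) (by fun_prop)
  have hS : ∀ y ∈ Icc (0 : ℝ) 1, |F y| ≤ |F x| := fun y hy => hmax hy
  have key : ∀ y ∈ Icc (0 : ℝ) 1, |F y - 1| ≤ |F x| * pot n M 1 := fun y hy => by
    have := abs_pot_mul_le (n := n) hM c hM0 hS hy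
    rw [h.eqn y hy]
    simpa using this
  have hp : 0 ≤ pot n M 1 := by
    have := pot_monotoneOn (n := n) hM hM0 le_rfl zero_le_one le_rfl
    rwa [pot_zero] at this
  have hx1 : |F x| ≤ 2 := by
    have h1 := key x hx
    have h2 : |F x| ≤ |F x - 1| + 1 := by
      have := abs_add_le (F x - 1) 1
      simpa using this
    have h3 := mul_le_mul_of_nonneg_left hpot (abs_nonneg (F x))
    linarith
  exact (key r hr).trans (mul_le_mul_of_nonneg_right hx1 hp)

/-! ### Equivalence with the Sturm–Liouville problem. -/

/-- An integral solution agrees on `[0,1]` with a classical solution. -/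
theorem IsVolterraSol.isSturmLiouvilleSol {f₀ : ℝ → ℝ} {n : ℕ} {Ω : ℝ} {M F : ℝ → ℝ}
    (h : IsVolterraSol n M F) (hM : Continuous M)
    (hMeq : ∀ r ∈ Ioo (0 : ℝ) 1, sigma f₀ Ω * nu f₀ Ω r = M r) :
    IsSturmLiouvilleSol f₀ n Ω (fun r => 1 - pot n (fun x => M x * F x) r) := by
  set k : ℝ → ℝ := fun x => M x * F x with hk
  have ck : Continuous k := hM.mul h.cont
  have hu := uniqueDiffOn_Icc (zero_lt_one (α := ℝ))
  have cd : ContDiff ℝ 2 (fun r => 1 - pot n k r) := contDiff_const.sub (contDiff_pot ck)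
  refine ⟨cd.contDiffOn, by simp [pot_zero], fun r hr => ?_⟩
  have hr' : r ∈ Icc (0 : ℝ) 1 := Ioo_subset_Icc_self hr
  have d1 : ∀ x ∈ Icc (0 : ℝ) 1,
      derivWithin (fun r => 1 - pot n k r) (Icc 0 1) x = -(x * avg n k x) := fun x hx =>
    ((hasDerivAt_pot ck x).const_sub 1).hasDerivWithinAt.derivWithin (hu x hx)
  have d2 : iteratedDerivWithin 2 (fun r => 1 - pot n k r) (Icc 0 1) r
      = -(k r - (2 * n + 1) * avg n k r) := by
    rw [iteratedDerivWithin_succ, iteratedDerivWithin_one, derivWithin_congr d1 (d1 r hr')]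
    exact (hasDerivAt_mul_avg ck r).neg.hasDerivWithinAt.derivWithin (hu r hr')
  have hr0 : r ≠ 0 := hr.1.ne'
  have hFr : 1 - pot n k r = F r := (h.eqn r hr').symm
  have hkr : k r = M r * F r := rfl
  simp only [d1 r hr', d2, hMeq r hr, hFr, hkr]
  field_simp
  ring

/-- A classical solution satisfies the integral equation. -/
theorem IsSturmLiouvilleSol.isVolterraSol {f₀ : ℝ → ℝ} {n : ℕ} {Ω : ℝ} {M G : ℝ → ℝ}
    (h : IsSturmLiouvilleSol f₀ n Ω G) (hM : Continuous M)
    (hMeq : ∀ r ∈ Ioo (0 : ℝ) 1, sigma f₀ Ω * nu f₀ Ω r = M r) :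
    ∃ F, IsVolterraSol n M F ∧ EqOn G F (Icc 0 1) := by
  obtain ⟨hG, hG0, hode⟩ := h
  have hu := uniqueDiffOn_Icc (zero_lt_one (α := ℝ))
  have hi : ∀ r ∈ Ioo (0 : ℝ) 1, Icc (0 : ℝ) 1 ∈ nhds r := fun r hr => Icc_mem_nhds hr.1 hr.2
  set F := IccExtend (zero_le_one (α := ℝ)) ((Icc (0 : ℝ) 1).domRestrict G) with hF
  have cF : Continuous F := (continuousOn_iff_continuous_domRestrict.1 hG.continuousOn).Icc_extend'
  have hGF : EqOn G F (Icc 0 1) := fun r hr => by rw [hF, IccExtend_of_mem _ _ hr]; rfl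
  refine ⟨F, ⟨cF, ?_⟩, hGF⟩
  set k : ℝ → ℝ := fun x => M x * F x with hk
  have ck : Continuous k := hM.mul cF
  set G' := derivWithin G (Icc 0 1) with hG'
  have cG' : ContDiffOn ℝ 1 G' (Icc 0 1) := hG.derivWithin hu (by norm_num)
  have dG : ∀ r ∈ Ioo (0 : ℝ) 1, HasDerivAt G (G' r) r := fun r hr =>
    ((hG.differentiableOn (by norm_num) r
      (Ioo_subset_Icc_self hr)).hasDerivWithinAt).hasDerivAt (hi r hr)
  have dG' : ∀ r ∈ Ioo (0 : ℝ) 1,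
      HasDerivAt G' (iteratedDerivWithin 2 G (Icc 0 1) r) r := fun r hr => by
    have e : iteratedDerivWithin 2 G (Icc 0 1) r = derivWithin G' (Icc 0 1) r := by
      rw [iteratedDerivWithin_succ]
      refine derivWithin_congr (fun x _ => ?_) ?_ <;> rw [iteratedDerivWithin_one]
    rw [e]
    exact ((cG'.differentiableOn (by norm_num) r
      (Ioo_subset_Icc_self hr)).hasDerivWithinAt).hasDerivAt (hi r hr)
  have const : ∀ φ : ℝ → ℝ, ContinuousOn φ (Icc 0 1) →
      (∀ r ∈ Ioo (0 : ℝ) 1, HasDerivAt φ 0 r) → ∀ r ∈ Icc (0 : ℝ) 1, φ r = φ 0 := by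
    intro φ hc hd r hr
    rcases eq_or_lt_of_le hr.1 with h0 | h0
    · rw [← h0]
    · obtain ⟨c, _, hc'⟩ := exists_hasDerivAt_eq_slope φ (fun _ => 0) h0
        (hc.mono (Icc_subset_Icc_right hr.2))
        fun x hx => hd x ⟨hx.1, hx.2.trans_le hr.2⟩
      have := (div_eq_zero_iff.1 hc'.symm).resolve_right (by linarith)
      linarith
  -- The ODE says that `r^{2n+1} G' + r^{2n+2} avg n k` has zero derivative. It vanishes at `0`
  -- because `G'` is continuous up to the end point, which excludes the singular solution.
  have h1 : ∀ r ∈ Ioo (0 : ℝ) 1, G' r = -(r * avg n k r) := by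
    intro r hr
    have h2 := const (fun r => r ^ (2 * n + 1) * G' r + r ^ (2 * n + 2) * avg n k r)
      (((continuousOn_id.pow _).mul cG'.continuousOn).add
        ((continuousOn_id.pow _).mul (continuous_avg ck).continuousOn)) (fun x hx => by
      refine (((hasDerivAt_pow (2 * n + 1) x).mul (dG' x hx)).add
        (hasDerivAt_pow_mul_avg ck x)).congr_deriv ?_
      have hx0 : x ≠ 0 := hx.1.ne'
      have ho := hode x hx
      rw [hMeq x hx] at ho
      have hkx : k x = M x * G x := by rw [hGF (Ioo_subset_Icc_self hx)]
      rw [hkx, show M x * G x = -(iteratedDerivWithin 2 G (Icc 0 1) x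
        + (2 * (n : ℝ) + 1) / x * G' x) by linarith]
      push_cast
      field_simp
      ring) r (Ioo_subset_Icc_self hr)
    simp only [ne_eq, Nat.add_eq_zero_iff, one_ne_zero, and_false, not_false_eq_true, zero_pow,
      zero_mul, OfNat.ofNat_ne_zero, add_zero] at h2
    have h3 : r ^ (2 * n + 1) * (G' r + r * avg n k r) = 0 := by rw [← h2]; ring
    have := (mul_eq_zero.1 h3).resolve_left (pow_ne_zero _ hr.1.ne')
    linarith
  intro r hr
  have h2 := const (fun r => G r + pot n k r)
    (hG.continuousOn.add (contDiff_pot ck).continuous.continuousOn) (fun x hx => by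
      refine ((dG x hx).add (hasDerivAt_pot ck x)).congr_deriv ?_
      rw [h1 x hx]
      ring) r hr
  simp only [pot_zero, hG0] at h2
  rw [← hGF hr]
  linarith

/-- Well-posedness, and identification of `slSol` with the integral solution. -/
theorem IsVolterraSol.hasUnique {f₀ : ℝ → ℝ} {n : ℕ} {Ω : ℝ} {M F : ℝ → ℝ}
    (h : IsVolterraSol n M F) (hM : Continuous M) (hM0 : ∀ r ∈ Icc (0 : ℝ) 1, 0 ≤ M r)
    (hpot : pot n M 1 ≤ 1 / 2) (hMeq : ∀ r ∈ Ioo (0 : ℝ) 1, sigma f₀ Ω * nu f₀ Ω r = M r) :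
    HasUniqueSturmLiouvilleSol f₀ n Ω ∧ EqOn (slSol f₀ n Ω) F (Icc 0 1) := by
  have hsol := h.isSturmLiouvilleSol hM hMeq
  have huniq : ∀ G, IsSturmLiouvilleSol f₀ n Ω G → EqOn G F (Icc 0 1) := fun G hG => by
    obtain ⟨F', hF', he⟩ := hG.isVolterraSol hM hMeq
    exact he.trans (hF'.eqOn h hM hM0 hpot)
  exact ⟨⟨_, hsol, fun G hG => (huniq G hG).trans (huniq _ hsol).symm⟩,
    huniq _ (Classical.epsilon_spec ⟨_, hsol⟩)⟩

/-! ### Radial data: bounds on the mean, the potential and `Ω̂_n`. -/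

/-- A globally continuous model of a radial profile: `f` is the profile, `q = f' / (2r)`, with
`c ≤ q ≤ L`, and the corresponding two-sided bound on the increments of `f`. -/
structure RadialData (f q : ℝ → ℝ) (c L : ℝ) : Prop where
  cont_f : Continuous f
  cont_q : Continuous q
  pos : 0 < c
  le_q : ∀ r, c ≤ q r
  q_le : ∀ r, q r ≤ L
  le_sub : ∀ s t, 0 ≤ s → s ≤ t → t ≤ 1 → c * (t ^ 2 - s ^ 2) ≤ f t - f s
  sub_le : ∀ s t, 0 ≤ s → s ≤ t → t ≤ 1 → f t - f s ≤ L * (t ^ 2 - s ^ 2)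
  neg : f 1 < 0

/-- `∫₀¹ s f(sr) ds`, extended from `[0,1]` by constants. -/
def mean (f : ℝ → ℝ) (r : ℝ) : ℝ := ∫ s in (0 : ℝ)..1, s * f (s * max 0 (min r 1))

/-- The potential `f'(r) / (r (Ω - ∫₀¹ s f(sr) ds))` in terms of `q = f' / (2r)`. -/
def potential (f q : ℝ → ℝ) (Ω r : ℝ) : ℝ := 2 * q r / (Ω - mean f r)

/-- The dispersion functional evaluated at an arbitrary function `F`. -/
def dispersion (f : ℝ → ℝ) (n : ℕ) (Ω : ℝ) (F : ℝ → ℝ) : ℝ :=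
  F 1 * (Ω - (n : ℝ) / (n + 1) * mean f 1)
    + ∫ s in (0 : ℝ)..1, F s * s ^ (2 * n + 1) * (f s - 2 * Ω)

theorem mean_of_mem {f : ℝ → ℝ} {r : ℝ} (hr : r ∈ Icc (0 : ℝ) 1) :
    mean f r = ∫ s in (0 : ℝ)..1, s * f (s * r) := by
  rw [mean, min_eq_left hr.2, max_eq_right hr.1]

theorem mean_one (f : ℝ → ℝ) : mean f 1 = ∫ s in (0 : ℝ)..1, s * f s := by
  rw [mean_of_mem (by simp)]
  simp

theorem continuous_mean {f : ℝ → ℝ} (hf : Continuous f) : Continuous (mean f) := by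
  unfold mean
  apply intervalIntegral.continuous_parametric_intervalIntegral_of_continuous'
  fun_prop

theorem integral_one_sub_sq_mul_pow (n : ℕ) :
    ∫ s in (0 : ℝ)..1, (1 - s ^ 2) * s ^ (2 * n + 1) = 1 / (2 * ((n : ℝ) + 1) * (n + 2)) := by
  have : ∀ s : ℝ, (1 - s ^ 2) * s ^ (2 * n + 1) = s ^ (2 * n + 1) - s ^ (2 * n + 3) :=
    fun s => by ring
  simp only [this]
  rw [intervalIntegral.integral_sub (Continuous.intervalIntegrable (by fun_prop) _ _)
    (Continuous.intervalIntegrable (by fun_prop) _ _), integral_pow, integral_pow]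
  push_cast
  simp only [one_pow, ne_eq, Nat.add_eq_zero_iff, one_ne_zero, and_false, not_false_eq_true,
    zero_pow, OfNat.ofNat_ne_zero]
  have h1 : (2 * (n : ℝ) + 1 + 1) ≠ 0 := by positivity
  have h2 : (2 * (n : ℝ) + 3 + 1) ≠ 0 := by positivity
  field_simp
  ring

theorem integral_zero_one_pow (n : ℕ) :
    ∫ s in (0 : ℝ)..1, s ^ (2 * n + 1) = 1 / (2 * ((n : ℝ) + 1)) := by
  rw [integral_pow]
  push_cast
  rw [one_pow, zero_pow (by lia)]
  congr 1 <;> ring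

namespace RadialData

variable {f q : ℝ → ℝ} {c L : ℝ}

theorem le_L (h : RadialData f q c L) : c ≤ L := (h.le_q 0).trans (h.q_le 0)

theorem L_pos (h : RadialData f q c L) : 0 < L := h.pos.trans_le h.le_L

theorem mean_sub_mean (h : RadialData f q c L) {r : ℝ} (hr : r ∈ Icc (0 : ℝ) 1) :
    c / 4 * (1 - r ^ 2) ≤ mean f 1 - mean f r ∧ mean f 1 - mean f r ≤ L / 4 * (1 - r ^ 2) := by
  have hf := h.cont_f
  have e : mean f 1 - mean f r = ∫ s in (0 : ℝ)..1, s * (f s - f (s * r)) := by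
    rw [mean_one, mean_of_mem hr, ← intervalIntegral.integral_sub
      (Continuous.intervalIntegrable (by fun_prop) _ _)
      (Continuous.intervalIntegrable (by fun_prop) _ _)]
    simp only [mul_sub]
  have e2 : ∀ a : ℝ, ∫ s in (0 : ℝ)..1, s * (a * (s ^ 2 - (s * r) ^ 2)) = a / 4 * (1 - r ^ 2) := by
    intro a
    have : ∀ s : ℝ, s * (a * (s ^ 2 - (s * r) ^ 2)) = (a * (1 - r ^ 2)) * s ^ 3 := fun s => by ring
    simp only [this, intervalIntegral.integral_const_mul, integral_pow]
    norm_num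
    ring
  rw [e, ← e2, ← e2]
  constructor <;>
  refine intervalIntegral.integral_mono_on zero_le_one
    (Continuous.intervalIntegrable (by fun_prop) _ _)
    (Continuous.intervalIntegrable (by fun_prop) _ _) fun s hs =>
    mul_le_mul_of_nonneg_left ?_ hs.1
  · exact h.le_sub _ _ (mul_nonneg hs.1 hr.1) (mul_le_of_le_one_right hs.1 hr.2) hs.2
  · exact h.sub_le _ _ (mul_nonneg hs.1 hr.1) (mul_le_of_le_one_right hs.1 hr.2) hs.2

theorem mean_le (h : RadialData f q c L) (r : ℝ) : mean f r ≤ mean f 1 := by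
  have hp : max 0 (min r 1) ∈ Icc (0 : ℝ) 1 := ⟨le_max_left _ _, by simp⟩
  have e : mean f r = mean f (max 0 (min r 1)) := by
    conv_rhs => rw [mean_of_mem hp]
    rfl
  rw [e]
  have := (h.mean_sub_mean hp).1
  have h2 : (max 0 (min r 1)) ^ 2 ≤ 1 := pow_le_one₀ hp.1 hp.2
  have := mul_nonneg (div_nonneg h.pos.le zero_le_four) (sub_nonneg.2 h2)
  linarith

theorem continuous_potential (h : RadialData f q c L) {Ω : ℝ} (hΩ : mean f 1 < Ω) :
    Continuous (potential f q Ω) := by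
  have h1 := h.cont_q
  have h2 := continuous_mean h.cont_f
  unfold potential
  refine Continuous.div (by fun_prop) (by fun_prop) fun r => ?_
  have := h.mean_le r
  exact (by linarith : 0 < Ω - mean f r).ne'

theorem potential_pos (h : RadialData f q c L) {Ω : ℝ} (hΩ : mean f 1 < Ω) (r : ℝ) :
    0 < potential f q Ω r := by
  have := h.mean_le r
  have := h.le_q r
  have := h.pos
  exact div_pos (by linarith) (by linarith)

theorem le_potential (h : RadialData f q c L) {Ω : ℝ} (hΩ : mean f 1 < Ω)
    (hΩ1 : Ω ≤ mean f 1 + 1) {r : ℝ} (hr : r ∈ Icc (0 : ℝ) 1) :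
    2 * c / (1 + L) ≤ potential f q Ω r := by
  have h1 := h.mean_le r
  have h2 := h.le_q r
  have h3 := h.pos
  have h4 := (h.mean_sub_mean hr).2
  have h5 := h.L_pos
  have : L / 4 * (1 - r ^ 2) ≤ L := by nlinarith [sq_nonneg r]
  exact div_le_div₀ (by linarith) (by linarith) (by linarith) (by linarith)

/-- By `mean_sub_mean` the denominator is at least `a + c/4 (1 - s²)`, and the resulting majorant
has an explicit logarithmic primitive. A gap `a` thus costs only `log (1/a)`, not `1/a`. -/
theorem integral_mul_potential_le (h : RadialData f q c L) {Ω a : ℝ} (ha : 0 < a)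
    (hΩ : mean f 1 + a ≤ Ω) :
    ∫ s in (0 : ℝ)..1, s * potential f q Ω s ≤ 4 * L / c * Real.log (1 + c / (4 * a)) := by
  have hc := h.pos
  have hL := h.L_pos
  have hM := h.continuous_potential (Ω := Ω) (by linarith)
  have hden : ∀ s ∈ Icc (0 : ℝ) 1, 0 < a + c / 4 * (1 - s ^ 2) := fun s hs => by
    have h2 : s ^ 2 ≤ 1 := pow_le_one₀ hs.1 hs.2
    have := mul_nonneg (div_nonneg hc.le zero_le_four) (sub_nonneg.2 h2)
    linarith
  have hcont : ContinuousOn (fun s => s * (2 * L / (a + c / 4 * (1 - s ^ 2)))) (Icc 0 1) :=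
    continuousOn_id.mul (continuousOn_const.div (by fun_prop) fun s hs => (hden s hs).ne')
  have hint : IntervalIntegrable (fun s => s * (2 * L / (a + c / 4 * (1 - s ^ 2))))
      MeasureTheory.volume 0 1 := by
    apply ContinuousOn.intervalIntegrable
    rwa [uIcc_of_le zero_le_one]
  have step : ∫ s in (0 : ℝ)..1, s * potential f q Ω s
      ≤ ∫ s in (0 : ℝ)..1, s * (2 * L / (a + c / 4 * (1 - s ^ 2))) := by
    refine intervalIntegral.integral_mono_on zero_le_one
      (Continuous.intervalIntegrable (by fun_prop) _ _) hint fun s hs =>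
      mul_le_mul_of_nonneg_left ?_ hs.1
    have h2 := (h.mean_sub_mean hs).1
    have := h.q_le s
    exact div_le_div₀ (by linarith) (by linarith) (hden s hs) (by linarith)
  have hd : ∀ s ∈ uIcc (0 : ℝ) 1,
      HasDerivAt (fun s => -(4 * L / c) * Real.log (a + c / 4 * (1 - s ^ 2)))
        (s * (2 * L / (a + c / 4 * (1 - s ^ 2)))) s := fun s hs => by
    rw [uIcc_of_le zero_le_one] at hs
    have h0 := (hden s hs).ne'
    have h1 : HasDerivAt (fun s : ℝ => a + c / 4 * (1 - s ^ 2)) (c / 4 * (-(2 * s))) s := by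
      refine ((((hasDerivAt_pow 2 s).const_sub 1).const_mul (c / 4)).const_add a).congr_deriv ?_
      simp
    refine ((h1.log h0).const_mul (-(4 * L / c))).congr_deriv ?_
    have hc' := hc.ne'
    field_simp
  refine step.trans (le_of_eq ?_)
  rw [intervalIntegral.integral_eq_sub_of_hasDerivAt hd hint]
  have e : 1 + c / (4 * a) = (a + c / 4) / a := by field_simp
  rw [e, Real.log_div (by positivity) ha.ne']
  norm_num
  ring

theorem pot_potential_le (h : RadialData f q c L) {Ω a : ℝ} (ha : 0 < a)
    (hΩ : mean f 1 + a ≤ Ω) {n : ℕ} (hn : 1 ≤ n) :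
    pot n (potential f q Ω) 1 ≤ 4 * L / c * Real.log (1 + c / (4 * a)) / (2 * n) :=
  (pot_one_le hn (h.continuous_potential (by linarith))
    fun r _ => (h.potential_pos (by linarith) r).le).trans
    (div_le_div_of_nonneg_right (h.integral_mul_potential_le ha hΩ) (by positivity))

/-- The weight `s^{2n+1}` concentrates at `s = 1`, so `f s` may be replaced by `f 1` at a cost
controlled by `f 1 - f s ≤ L (1 - s²)`. -/
theorem omegaHat_sub (h : RadialData f q c L) {n : ℕ} (hn : 1 ≤ n) :
    -f 1 / (2 * n) ≤ omegaHat f n - mean f 1 ∧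
      omegaHat f n - mean f 1 ≤ -f 1 / (2 * n) + L / (2 * (n : ℝ) ^ 2) := by
  have hf := h.cont_f
  have hn0 : (0 : ℝ) < n := by exact_mod_cast hn
  have e : omegaHat f n - mean f 1
      = -(((n : ℝ) + 1) / n * ∫ s in (0 : ℝ)..1, s ^ (2 * n + 1) * f s) := by
    rw [mean_one, omegaHat]
    ring
  have up : ∫ s in (0 : ℝ)..1, s ^ (2 * n + 1) * f s ≤ f 1 / (2 * (n + 1)) := by
    have e1 : f 1 / (2 * (n + 1)) = ∫ s in (0 : ℝ)..1, s ^ (2 * n + 1) * f 1 := by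
      rw [intervalIntegral.integral_mul_const, integral_zero_one_pow]
      ring
    rw [e1]
    refine intervalIntegral.integral_mono_on zero_le_one
      (Continuous.intervalIntegrable (by fun_prop) _ _)
      (Continuous.intervalIntegrable (by fun_prop) _ _) fun s hs =>
      mul_le_mul_of_nonneg_left ?_ (pow_nonneg hs.1 _)
    have h1 := h.le_sub s 1 hs.1 hs.2 le_rfl
    have h2 : s ^ 2 ≤ 1 := pow_le_one₀ hs.1 hs.2
    have := mul_nonneg h.pos.le (sub_nonneg.2 h2)
    linarith
  have lo : f 1 / (2 * (n + 1)) - L * (1 / (2 * (n + 1) * (n + 2)))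
      ≤ ∫ s in (0 : ℝ)..1, s ^ (2 * n + 1) * f s := by
    have e1 : f 1 / (2 * (n + 1)) - L * (1 / (2 * (n + 1) * (n + 2)))
        = ∫ s in (0 : ℝ)..1, (s ^ (2 * n + 1) * f 1 - L * ((1 - s ^ 2) * s ^ (2 * n + 1))) := by
      rw [intervalIntegral.integral_sub (Continuous.intervalIntegrable (by fun_prop) _ _)
        (Continuous.intervalIntegrable (by fun_prop) _ _), intervalIntegral.integral_const_mul,
        intervalIntegral.integral_mul_const, integral_zero_one_pow, integral_one_sub_sq_mul_pow]
      ring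
    rw [e1]
    refine intervalIntegral.integral_mono_on zero_le_one
      (Continuous.intervalIntegrable (by fun_prop) _ _)
      (Continuous.intervalIntegrable (by fun_prop) _ _) fun s hs => ?_
    have h1 := h.sub_le s 1 hs.1 hs.2 le_rfl
    have := mul_le_mul_of_nonneg_left h1 (pow_nonneg hs.1 (2 * n + 1))
    linarith
  have hk : (0 : ℝ) < ((n : ℝ) + 1) / n := by positivity
  rw [e]
  constructor
  · have := mul_le_mul_of_nonneg_left up hk.le
    have e2 : ((n : ℝ) + 1) / n * (f 1 / (2 * (n + 1))) = f 1 / (2 * n) := by field_simp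
    rw [e2] at this
    rw [neg_div]
    linarith
  · have := mul_le_mul_of_nonneg_left lo hk.le
    have e2 : ((n : ℝ) + 1) / n * (f 1 / (2 * (n + 1)) - L * (1 / (2 * (n + 1) * (n + 2))))
        = f 1 / (2 * n) - L / (2 * (n * (n + 2))) := by field_simp
    rw [e2] at this
    have h3 : L / (2 * ((n : ℝ) * (n + 2))) ≤ L / (2 * (n : ℝ) ^ 2) :=
      div_le_div_of_nonneg_left h.L_pos.le (by positivity) (by nlinarith)
    rw [neg_div]
    linarith

/-! ### The dispersion functional: main term, correction, continuity. -/

theorem dispersion_eq (h : RadialData f q c L) {n : ℕ} (hn : 1 ≤ n) (Ω : ℝ) {F : ℝ → ℝ}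
    (hF : Continuous F) :
    dispersion f n Ω F = F 1 * ((n : ℝ) / (n + 1)) * (Ω - omegaHat f n)
      + ∫ s in (0 : ℝ)..1, (F s - F 1) * (s ^ (2 * n + 1) * (f s - 2 * Ω)) := by
  have hf := h.cont_f
  have hn0 : (0 : ℝ) < n := by exact_mod_cast hn
  have e : ∀ s, (F s - F 1) * (s ^ (2 * n + 1) * (f s - 2 * Ω))
      = F s * s ^ (2 * n + 1) * (f s - 2 * Ω)
        - (F 1 * (s ^ (2 * n + 1) * f s) - F 1 * (2 * Ω) * s ^ (2 * n + 1)) := fun s => by ring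
  simp only [e]
  rw [intervalIntegral.integral_sub (Continuous.intervalIntegrable (by fun_prop) _ _)
      (Continuous.intervalIntegrable (by fun_prop) _ _),
    intervalIntegral.integral_sub (Continuous.intervalIntegrable (by fun_prop) _ _)
      (Continuous.intervalIntegrable (by fun_prop) _ _),
    intervalIntegral.integral_const_mul, intervalIntegral.integral_const_mul,
    integral_zero_one_pow, dispersion, omegaHat, mean_one]
  field_simp
  ring

/-- The quantity is `∫ 2s (f 1 - f s)`. Its positivity fixes the sign of `f - 2Ω` near `s = 1` when
`Ω` is close to `κ₂`, hence the sign of the correction. -/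
theorem two_mul_mean_one (h : RadialData f q c L) :
    c / 2 ≤ f 1 - 2 * mean f 1 ∧ f 1 - 2 * mean f 1 ≤ L / 2 := by
  have hf := h.cont_f
  have e : f 1 - 2 * mean f 1 = ∫ s in (0 : ℝ)..1, 2 * (s * (f 1 - f s)) := by
    simp only [mul_sub]
    rw [intervalIntegral.integral_sub (Continuous.intervalIntegrable (by fun_prop) _ _)
      (Continuous.intervalIntegrable (by fun_prop) _ _), mean_one,
      intervalIntegral.integral_const_mul, intervalIntegral.integral_const_mul,
      intervalIntegral.integral_mul_const, integral_id]
    ring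
  have e2 : ∀ a : ℝ, a / 2 = ∫ s in (0 : ℝ)..1, 2 * (s * (a * (1 ^ 2 - s ^ 2))) := by
    intro a
    have : ∀ s : ℝ, 2 * (s * (a * (1 ^ 2 - s ^ 2)))
        = 2 * a * ((1 - s ^ 2) * s ^ (2 * 0 + 1)) := fun s => by ring
    simp only [this, intervalIntegral.integral_const_mul, integral_one_sub_sq_mul_pow]
    norm_num
    ring
  rw [e, e2 c, e2 L]
  constructor <;>
  refine intervalIntegral.integral_mono_on zero_le_one
    (Continuous.intervalIntegrable (by fun_prop) _ _)
    (Continuous.intervalIntegrable (by fun_prop) _ _) fun s hs =>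
    mul_le_mul_of_nonneg_left (mul_le_mul_of_nonneg_left ?_ hs.1) zero_le_two
  · exact h.le_sub _ _ hs.1 hs.2 le_rfl
  · exact h.sub_le _ _ hs.1 hs.2 le_rfl

theorem abs_sub_two_mul_le (h : RadialData f q c L) {Ω : ℝ} (hΩ : mean f 1 < Ω)
    (hΩ1 : Ω ≤ mean f 1 + 1) {s : ℝ} (hs : s ∈ Icc (0 : ℝ) 1) : |f s - 2 * Ω| ≤ L + 2 := by
  have h1 := h.two_mul_mean_one
  have h2 := h.sub_le s 1 hs.1 hs.2 le_rfl
  have h3 := h.le_sub s 1 hs.1 hs.2 le_rfl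
  have h4 : s ^ 2 ≤ 1 := pow_le_one₀ hs.1 hs.2
  have h5 := mul_nonneg h.pos.le (sub_nonneg.2 h4)
  have h6 := mul_nonneg h.L_pos.le (sq_nonneg s)
  have := h.pos
  have := h.L_pos
  rw [abs_le]
  constructor <;> linarith

theorem abs_integral_le (h : RadialData f q c L) {Ω : ℝ} (hΩ : mean f 1 < Ω)
    (hΩ1 : Ω ≤ mean f 1 + 1) {n : ℕ} {w : ℝ → ℝ} {W : ℝ}
    (hW : ∀ s ∈ Icc (0 : ℝ) 1, |w s| ≤ W) :
    |∫ s in (0 : ℝ)..1, w s * (s ^ (2 * n + 1) * (f s - 2 * Ω))|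
      ≤ W * (L + 2) / (2 * (n + 1)) := by
  have hW0 : 0 ≤ W := (abs_nonneg _).trans (hW 0 (by simp))
  have e : W * (L + 2) / (2 * (n + 1)) = ∫ s in (0 : ℝ)..1, W * (L + 2) * s ^ (2 * n + 1) := by
    rw [intervalIntegral.integral_const_mul, integral_zero_one_pow]
    ring
  rw [e, ← Real.norm_eq_abs]
  refine intervalIntegral.norm_integral_le_of_norm_le zero_le_one ?_
    (Continuous.intervalIntegrable (by fun_prop) _ _)
  refine Filter.Eventually.of_forall fun s hs => ?_
  have hs' : s ∈ Icc (0 : ℝ) 1 := Ioc_subset_Icc_self hs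
  rw [Real.norm_eq_abs, abs_mul, abs_mul, abs_of_nonneg (pow_nonneg hs'.1 _)]
  have := mul_le_mul (hW s hs') (h.abs_sub_two_mul_le hΩ hΩ1 hs') (abs_nonneg _) hW0
  have := mul_le_mul_of_nonneg_right this (pow_nonneg hs'.1 (2 * n + 1))
  linarith

/-- Lower bound for the correction term of the dispersion functional: the weight `s^{2n+1}`
concentrates where `f - 2Ω` is positive, up to an exponentially small error. -/
theorem le_integral (h : RadialData f q c L) {Ω : ℝ} (hΩ1 : Ω ≤ mean f 1 + c / 16)
    {n : ℕ} {w : ℝ → ℝ} {γ : ℝ} (hw : Continuous w)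
    (hlow : ∀ s ∈ Icc (0 : ℝ) 1, γ * (1 - s ^ 2) ≤ w s) (hγ : 0 ≤ γ)
    (hup : ∀ s ∈ Icc (0 : ℝ) 1, w s ≤ 1) :
    c / 4 * γ / (2 * (n + 1) * (n + 2)) - 2 * L * (1 - c / (8 * L)) ^ n
      ≤ ∫ s in (0 : ℝ)..1, w s * (s ^ (2 * n + 1) * (f s - 2 * Ω)) := by
  have hf := h.cont_f
  have hc := h.pos
  have hL := h.L_pos
  have hcL := h.le_L
  set ρ := 1 - c / (8 * L) with hρ
  -- This choice of `ρ` gives `f s - 2Ω ≥ c/2 - c/8 - c/8 = c/4` once `s² ≥ ρ`. Where `s² ≤ ρ`, the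
  -- weight is at most `ρ^n`.
  have hLρ : L * (1 - ρ) = c / 8 := by rw [hρ]; field_simp; ring
  have hρ0 : 0 ≤ ρ := by
    rw [hρ, sub_nonneg, div_le_one (by positivity)]
    linarith
  have e : c / 4 * γ / (2 * (n + 1) * (n + 2)) - 2 * L * ρ ^ n
      = ∫ s in (0 : ℝ)..1, (c / 4 * γ * ((1 - s ^ 2) * s ^ (2 * n + 1)) - 2 * L * ρ ^ n) := by
    rw [intervalIntegral.integral_sub (Continuous.intervalIntegrable (by fun_prop) _ _)
      (Continuous.intervalIntegrable (by fun_prop) _ _), intervalIntegral.integral_const_mul,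
      integral_one_sub_sq_mul_pow, intervalIntegral.integral_const, sub_zero, one_smul, mul_one_div]
  rw [e]
  refine intervalIntegral.integral_mono_on zero_le_one
    (Continuous.intervalIntegrable (by fun_prop) _ _)
    (Continuous.intervalIntegrable (by fun_prop) _ _) fun s hs => ?_
  have h2 : s ^ 2 ≤ 1 := pow_le_one₀ hs.1 hs.2
  have hp : 0 ≤ s ^ (2 * n + 1) := pow_nonneg hs.1 _
  have hw0 : 0 ≤ w s := (mul_nonneg hγ (sub_nonneg.2 h2)).trans (hlow s hs)
  have hfs : c / 2 - L * (1 - s ^ 2) - c / 8 ≤ f s - 2 * Ω := by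
    have := h.sub_le s 1 hs.1 hs.2 le_rfl
    have := h.two_mul_mean_one.1
    linarith
  have key : c / 4 * s ^ (2 * n + 1) - 2 * L * ρ ^ n ≤ s ^ (2 * n + 1) * (f s - 2 * Ω) := by
    have hρn : 0 ≤ 2 * L * ρ ^ n := by positivity
    rcases le_total ρ (s ^ 2) with hs2 | hs2
    · have : c / 4 ≤ f s - 2 * Ω := by
        have := mul_le_mul_of_nonneg_left (sub_le_sub_left hs2 1) hL.le
        linarith
      have := mul_le_mul_of_nonneg_left this hp
      linarith
    · have h3 : s ^ (2 * n + 1) ≤ ρ ^ n := by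
        rw [pow_succ, pow_mul]
        exact (mul_le_of_le_one_right (by positivity) hs.2).trans
          (pow_le_pow_left₀ (sq_nonneg s) hs2 n)
      have h4 : -(2 * L) ≤ f s - 2 * Ω - c / 4 := by
        have := mul_nonneg hL.le (sq_nonneg s)
        linarith
      have := mul_le_mul_of_nonneg_left h4 hp
      have := mul_le_mul_of_nonneg_left h3 (by positivity : 0 ≤ 2 * L)
      linarith
  have k1 := mul_le_mul_of_nonneg_left key hw0
  have k2 := mul_le_mul_of_nonneg_right (hlow s hs) (mul_nonneg (by positivity : 0 ≤ c / 4) hp)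
  have k3 := mul_le_mul_of_nonneg_right (hup s hs) (by positivity : 0 ≤ 2 * L * ρ ^ n)
  linarith

/-- The integral solution is strictly decreasing, quantitatively. -/
theorem le_sub_one_of_isVolterraSol (h : RadialData f q c L) {Ω : ℝ} (hΩ : mean f 1 < Ω)
    (hΩ1 : Ω ≤ mean f 1 + 1) {n : ℕ} {F : ℝ → ℝ} (hF : IsVolterraSol n (potential f q Ω) F)
    (hpos : ∀ s ∈ Icc (0 : ℝ) 1, 1 / 2 ≤ F s) {s : ℝ} (hs : s ∈ Icc (0 : ℝ) 1) :
    c / (4 * (1 + L) * (n + 1)) * (1 - s ^ 2) ≤ F s - F 1 := by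
  have hM := h.continuous_potential hΩ
  have cF := hF.cont
  have hL := h.L_pos
  have hc := h.pos
  -- The constant is the product of the lower bounds `2c/(1+L)` for the potential and `1/2` for `F`.
  have := pot_sub_le (n := n) (h := fun _ => c / (1 + L)) (k := fun x => potential f q Ω x * F x)
    continuous_const (by fun_prop) (fun r hr => by
      have h1 := h.le_potential hΩ hΩ1 hr
      have h2 := mul_le_mul h1 (hpos r hr) (by norm_num) (h.potential_pos hΩ r).le
      refine le_trans (le_of_eq ?_) h2
      ring) hs.1 hs.2 le_rfl
  rw [pot_const, pot_const] at this
  rw [hF.eqn s hs, hF.eqn 1 (by simp)]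
  have e : c / (4 * (1 + L) * (n + 1)) * (1 - s ^ 2)
      = c / (1 + L) / (2 * n + 2) * (1 ^ 2 / 2) - c / (1 + L) / (2 * n + 2) * (s ^ 2 / 2) := by
    field_simp
    ring
  linarith

theorem abs_potential_sub_le (h : RadialData f q c L) {Ω Ω' a : ℝ} (ha : 0 < a)
    (hΩ : mean f 1 + a ≤ Ω) (hΩ' : mean f 1 + a ≤ Ω') (r : ℝ) :
    |potential f q Ω r - potential f q Ω' r| ≤ 2 * L / a ^ 2 * |Ω - Ω'| := by
  have h1 := h.mean_le r
  have p1 : a ≤ Ω - mean f r := by linarith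
  have p2 : a ≤ Ω' - mean f r := by linarith
  have hq0 : 0 < q r := h.pos.trans_le (h.le_q r)
  have d1 : Ω - mean f r ≠ 0 := (ha.trans_le p1).ne'
  have d2 : Ω' - mean f r ≠ 0 := (ha.trans_le p2).ne'
  have e : potential f q Ω r - potential f q Ω' r
      = 2 * q r / ((Ω - mean f r) * (Ω' - mean f r)) * (Ω' - Ω) := by
    unfold potential
    field_simp
    ring
  have hpos : 0 < 2 * q r / ((Ω - mean f r) * (Ω' - mean f r)) :=
    div_pos (by linarith) (mul_pos (ha.trans_le p1) (ha.trans_le p2))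
  rw [e, abs_mul, abs_of_pos hpos, abs_sub_comm]
  refine mul_le_mul_of_nonneg_right ?_ (abs_nonneg _)
  have := h.q_le r
  refine div_le_div₀ (by linarith) (by linarith) (by positivity) ?_
  rw [sq]
  exact mul_le_mul p1 p2 ha.le (by linarith)

/-- The dispersion functional depends continuously on `Ω` along integral solutions. -/
theorem continuousOn_dispersion (h : RadialData f q c L) {n : ℕ} {J : Set ℝ} {a : ℝ} (ha : 0 < a)
    (hJ : ∀ Ω ∈ J, mean f 1 + a ≤ Ω) (hJ1 : ∀ Ω ∈ J, Ω ≤ mean f 1 + 1)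
    (hpot : ∀ Ω ∈ J, pot n (potential f q Ω) 1 ≤ 1 / 2) {F : ℝ → ℝ → ℝ}
    (hF : ∀ Ω ∈ J, IsVolterraSol n (potential f q Ω) (F Ω)) :
    ContinuousOn (fun Ω => dispersion f n Ω (F Ω)) J := by
  have hf := h.cont_f
  have hlt : ∀ Ω ∈ J, mean f 1 < Ω := fun Ω hΩ => by have := hJ Ω hΩ; linarith
  have hbd : ∀ Ω ∈ J, ∀ s ∈ Icc (0 : ℝ) 1, |F Ω s| ≤ 2 := fun Ω hΩ s hs => by
    have h1 := (hF Ω hΩ).abs_sub_one_le (h.continuous_potential (hlt Ω hΩ))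
      (fun r _ => (h.potential_pos (hlt Ω hΩ) r).le) (hpot Ω hΩ) hs
    have h2 := abs_add_le (F Ω s - 1) 1
    have h3 := hpot Ω hΩ
    simp only [sub_add_cancel, abs_one] at h2
    linarith
  have hcF : ∀ s ∈ Icc (0 : ℝ) 1, ContinuousOn (fun Ω => F Ω s) J := fun s hs => by
    have hL := h.L_pos
    -- From the stability estimate with `B = 2` and `δ = (2L/a²) |Ω - Ω'|`.
    have hlip : LipschitzOnWith (Real.toNNReal (2 * (2 * (2 * L / a ^ 2)))) (fun Ω => F Ω s) J := by
      refine LipschitzOnWith.of_dist_le_mul fun x hx y hy => ?_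
      rw [Real.coe_toNNReal _ (by positivity), Real.dist_eq, Real.dist_eq]
      refine ((hF x hx).abs_sub_le (hF y hy) (h.continuous_potential (hlt x hx))
        (h.continuous_potential (hlt y hy)) (fun r _ => (h.potential_pos (hlt x hx) r).le)
        (hpot x hx) (fun r _ => h.abs_potential_sub_le ha (hJ x hx) (hJ y hy) r)
        (hbd y hy) hs).trans (le_of_eq ?_)
      ring
    exact hlip.continuousOn
  unfold dispersion
  refine ((hcF 1 (by simp)).mul (by fun_prop)).add fun Ω hΩ => ?_
  have hI : uIoc (0 : ℝ) 1 ⊆ Icc 0 1 := by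
    rw [uIoc_of_le zero_le_one]
    exact Ioc_subset_Icc_self
  refine intervalIntegral.continuousWithinAt_of_dominated_interval
    (bound := fun _ => 2 * (L + 2)) ?_ ?_ intervalIntegrable_const ?_
  · filter_upwards [self_mem_nhdsWithin] with x hx
    have := (hF x hx).cont
    exact (Continuous.aestronglyMeasurable (by fun_prop))
  · filter_upwards [self_mem_nhdsWithin] with x hx
    refine Filter.Eventually.of_forall fun s hs => ?_
    have hs' := hI hs
    rw [Real.norm_eq_abs, abs_mul, abs_mul, abs_of_nonneg (pow_nonneg hs'.1 _)]
    have h1 := mul_le_mul (hbd x hx s hs') (pow_le_one₀ hs'.1 hs'.2 (n := 2 * n + 1))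
      (pow_nonneg hs'.1 _) zero_le_two
    have := mul_le_mul h1 (h.abs_sub_two_mul_le (hlt x hx) (hJ1 x hx) hs') (abs_nonneg _)
      (by norm_num)
    linarith
  · refine Filter.Eventually.of_forall fun s hs => ?_
    exact ((hcF s (hI hs) Ω hΩ).mul continuousWithinAt_const).mul
      (by fun_prop)

end RadialData

/-! ### Locating the root. -/

namespace RadialData

variable {f q : ℝ → ℝ} {c L : ℝ}

/-- For a fixed symmetry `m` that is large in the quantitative sense of the hypotheses, the
dispersion functional has a root just below `Ω̂_m` that is not a root for any multiple of `m`. -/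
theorem exists_dispersion_root (h : RadialData f q c L) {m : ℕ} (hm : 1 ≤ m) {τ η : ℝ}
    (hτ : 0 < τ) (hgap : L / (2 * (m : ℝ) ^ 2) + τ ≤ -f 1 / (8 * m))
    (hnear : -f 1 / (2 * m) + L / (2 * (m : ℝ) ^ 2) ≤ 1)
    (hnear' : -f 1 / (2 * m) + L / (2 * (m : ℝ) ^ 2) ≤ c / 16)
    (hη : ∀ N : ℕ, m ≤ N → ∀ Ω, mean f 1 + -f 1 / (4 * m) ≤ Ω → pot N (potential f q Ω) 1 ≤ η)
    (hη4 : η ≤ 1 / 4) (hηf : 64 * (L + 2) * η < -f 1) (hητ : 8 * (L + 2) * η / m < τ)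
    (hexp : 2 * L * (1 - c / (8 * L)) ^ m
      < c ^ 2 / (32 * (1 + L) * ((m : ℝ) + 1) ^ 2 * (m + 2))) :
    ∃ Ω ∈ Ioo (omegaHat f m - τ) (omegaHat f m), mean f 1 < Ω ∧
      (∀ N : ℕ, m ≤ N → pot N (potential f q Ω) 1 ≤ 1 / 2) ∧
      (∀ F, IsVolterraSol m (potential f q Ω) F → dispersion f m Ω F = 0) ∧
      (∀ n : ℕ, 2 ≤ n → omegaHat f (n * m) < Ω) ∧
      (∀ n : ℕ, 2 ≤ n → ∀ F, IsVolterraSol (n * m) (potential f q Ω) F →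
        dispersion f (n * m) Ω F ≠ 0) := by
  have hc := h.pos
  have hL := h.L_pos
  have hb := h.neg
  have hm0 : (0 : ℝ) < m := by exact_mod_cast hm
  have hm1 : (1 : ℝ) ≤ m := by exact_mod_cast hm
  have hb4 : 0 < -f 1 / (4 * m) := div_pos (by linarith) (by positivity)
  obtain ⟨lo, up⟩ := h.omegaHat_sub hm
  have e8 : -f 1 / (8 * m) = (-f 1 / m) / 8 := by field_simp
  have e4 : -f 1 / (4 * m) = (-f 1 / m) / 4 := by field_simp
  have e2 : -f 1 / (2 * m) = (-f 1 / m) / 2 := by field_simp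
  have hLm : 0 < L / (2 * (m : ℝ) ^ 2) := by positivity
  set J := Icc (omegaHat f m - τ) (omegaHat f m) with hJ
  -- `Ω̂_m` lies at least `-f 1/(2m)` above the mean, and `hgap` limits `τ` to `-f 1/(8m)`.
  have hJlo : ∀ Ω ∈ J, mean f 1 + -f 1 / (4 * m) ≤ Ω := fun Ω hΩ => by
    have := hΩ.1
    rw [e4] at hb4 ⊢
    linarith
  have hJlt : ∀ Ω ∈ J, mean f 1 < Ω := fun Ω hΩ => by have := hJlo Ω hΩ; linarith
  have hJ1 : ∀ Ω ∈ J, Ω ≤ mean f 1 + 1 := fun Ω hΩ => by have := hΩ.2; linarith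
  have hJc : ∀ Ω ∈ J, Ω ≤ mean f 1 + c / 16 := fun Ω hΩ => by have := hΩ.2; linarith
  have hη2 : ∀ N : ℕ, m ≤ N → ∀ Ω ∈ J, pot N (potential f q Ω) 1 ≤ 1 / 2 := fun N hN Ω hΩ =>
    (hη N hN Ω (hJlo Ω hΩ)).trans (by linarith)
  have hclose : ∀ N : ℕ, m ≤ N → ∀ Ω ∈ J, ∀ F, IsVolterraSol N (potential f q Ω) F →
      ∀ s ∈ Icc (0 : ℝ) 1, |F s - 1| ≤ 2 * η := fun N hN Ω hΩ F hF s hs =>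
    (hF.abs_sub_one_le (h.continuous_potential (hJlt Ω hΩ))
      (fun r _ => (h.potential_pos (hJlt Ω hΩ) r).le) (hη2 N hN Ω hΩ) hs).trans
      (mul_le_mul_of_nonneg_left (hη N hN Ω (hJlo Ω hΩ)) zero_le_two)
  have hhalf : ∀ N : ℕ, m ≤ N → ∀ Ω ∈ J, ∀ F, IsVolterraSol N (potential f q Ω) F →
      ∀ s ∈ Icc (0 : ℝ) 1, 1 / 2 ≤ F s := fun N hN Ω hΩ F hF s hs => by
    have := (abs_le.1 (hclose N hN Ω hΩ F hF s hs)).1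
    linarith
  have hosc : ∀ N : ℕ, m ≤ N → ∀ Ω ∈ J, ∀ F, IsVolterraSol N (potential f q Ω) F →
      ∀ s ∈ Icc (0 : ℝ) 1, |F s - F 1| ≤ 4 * η := fun N hN Ω hΩ F hF s hs => by
    have h1 := abs_le.1 (hclose N hN Ω hΩ F hF s hs)
    have h2 := abs_le.1 (hclose N hN Ω hΩ F hF 1 (by simp))
    rw [abs_le]
    constructor <;> linarith
  have hη0 : 0 ≤ η := by
    have hΩ : omegaHat f m ∈ J := ⟨by linarith, le_rfl⟩
    have := pot_monotoneOn (n := m) (h.continuous_potential (hJlt _ hΩ))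
      (fun r _ => (h.potential_pos (hJlt _ hΩ) r).le) le_rfl zero_le_one le_rfl
    rw [pot_zero] at this
    exact this.trans (hη m le_rfl _ (hJlo _ hΩ))
  have hcorr : ∀ N : ℕ, m ≤ N → ∀ Ω ∈ J, ∀ F, IsVolterraSol N (potential f q Ω) F →
      |∫ s in (0 : ℝ)..1, (F s - F 1) * (s ^ (2 * N + 1) * (f s - 2 * Ω))|
        ≤ 2 * (L + 2) * η / m := fun N hN Ω hΩ F hF => by
    refine (h.abs_integral_le (hJlt Ω hΩ) (hJ1 Ω hΩ) (w := fun s => F s - F 1)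
      (hosc N hN Ω hΩ F hF)).trans ?_
    have hN' : (m : ℝ) ≤ N := by exact_mod_cast hN
    have e : 2 * (L + 2) * η / m = 4 * η * (L + 2) / (2 * m) := by field_simp; ring
    rw [e]
    exact div_le_div_of_nonneg_left (by positivity) (by positivity) (by linarith)
  have hmain : ∀ N : ℕ, m ≤ N → ∀ Ω ∈ J, ∀ F, IsVolterraSol N (potential f q Ω) F →
      1 / 4 ≤ F 1 * ((N : ℝ) / (N + 1)) := fun N hN Ω hΩ F hF => by
    have h1 := hhalf N hN Ω hΩ F hF 1 (by simp)
    have h2 : (1 : ℝ) / 2 ≤ N / (N + 1) := by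
      have hN' : (m : ℝ) ≤ N := by exact_mod_cast hN
      rw [div_le_div_iff₀ (by norm_num) (by linarith)]
      linarith
    calc (1 : ℝ) / 4 = 1 / 2 * (1 / 2) := by norm_num
      _ ≤ _ := mul_le_mul h1 h2 (by norm_num) (by linarith)
  -- The choice is made total, with the value `0` off `J`.
  have hex : ∀ Ω : ℝ, ∃ F, Ω ∈ J → IsVolterraSol m (potential f q Ω) F := fun Ω => by
    by_cases hΩ : Ω ∈ J
    · obtain ⟨F, hF⟩ := exists_isVolterraSol (h.continuous_potential (hJlt Ω hΩ))
        (fun r _ => (h.potential_pos (hJlt Ω hΩ) r).le) (hη2 m le_rfl Ω hΩ)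
      exact ⟨F, fun _ => hF⟩
    · exact ⟨0, fun h' => absurd h' hΩ⟩
  choose F hF using hex
  have hcont : ContinuousOn (fun Ω => dispersion f m Ω (F Ω)) J :=
    h.continuousOn_dispersion hb4 hJlo hJ1 (hη2 m le_rfl) hF
  -- The main term is at most `-τ/4`, and `hητ` makes the correction smaller than `τ/4`.
  have hleft : dispersion f m (omegaHat f m - τ) (F (omegaHat f m - τ)) < 0 := by
    have hΩ : omegaHat f m - τ ∈ J := ⟨le_rfl, by linarith⟩
    have hs := hF _ hΩ
    rw [h.dispersion_eq hm _ hs.cont]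
    have h1 := (abs_le.1 (hcorr m le_rfl _ hΩ _ hs)).2
    have h2 := mul_le_mul_of_nonneg_right (hmain m le_rfl _ hΩ _ hs) hτ.le
    have h3 : 2 * (L + 2) * η / m = (8 * (L + 2) * η / m) / 4 := by ring
    linarith
  -- Only the correction survives here; `hexp` says that its polynomial lower bound beats the
  -- exponentially small error.
  have hright : 0 < dispersion f m (omegaHat f m) (F (omegaHat f m)) := by
    have hΩ : omegaHat f m ∈ J := ⟨by linarith, le_rfl⟩
    have hs := hF _ hΩ
    have hsc := hs.cont
    rw [h.dispersion_eq hm _ hsc, sub_self, mul_zero, zero_add]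
    refine lt_of_lt_of_le ?_ (h.le_integral (hJc _ hΩ) (n := m)
      (w := fun s => F (omegaHat f m) s - F (omegaHat f m) 1)
      (γ := c / (4 * (1 + L) * (m + 1))) (by fun_prop)
      (fun s hs' => h.le_sub_one_of_isVolterraSol (hJlt _ hΩ) (hJ1 _ hΩ) hs
        (hhalf m le_rfl _ hΩ _ hs) hs') (by positivity)
      (fun s hs' => by
        have := (abs_le.1 (hosc m le_rfl _ hΩ _ hs s hs')).2
        linarith))
    have e : c / 4 * (c / (4 * (1 + L) * (m + 1))) / (2 * (m + 1) * (m + 2))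
        = c ^ 2 / (32 * (1 + L) * ((m : ℝ) + 1) ^ 2 * (m + 2)) := by
      field_simp
      ring
    rw [e]
    linarith
  obtain ⟨Ω, hΩ, hroot⟩ := intermediate_value_Ioo (by linarith) hcont ⟨hleft, hright⟩
  have hΩJ : Ω ∈ J := Ioo_subset_Icc_self hΩ
  -- For `n ≥ 2` the leading offsets from the mean differ by at least `-f 1/(2m) + f 1/(4m) = -f
  -- 1/(4m)`; `hgap` spends half of this on the errors.
  have hgap2 : ∀ n : ℕ, 2 ≤ n → omegaHat f (n * m) + -f 1 / (8 * m) ≤ Ω := fun n hn => by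
    have hn' : (2 : ℝ) ≤ n := by exact_mod_cast hn
    have h1 := (h.omegaHat_sub (n := n * m) (by nlinarith)).2
    have hN : 2 * (m : ℝ) ≤ ((n * m : ℕ) : ℝ) := by
      push_cast
      exact mul_le_mul_of_nonneg_right hn' hm0.le
    have h2 : -f 1 / (2 * ((n * m : ℕ) : ℝ)) ≤ -f 1 / (4 * m) :=
      div_le_div_of_nonneg_left (by linarith) (by positivity) (by linarith)
    have h3 : L / (2 * ((n * m : ℕ) : ℝ) ^ 2) ≤ L / (2 * (m : ℝ) ^ 2) := by
      refine div_le_div_of_nonneg_left hL.le (by positivity) ?_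
      have := pow_le_pow_left₀ hm0.le (by linarith : (m : ℝ) ≤ ((n * m : ℕ) : ℝ)) 2
      linarith
    have h4 := hΩ.1
    linarith
  have hb8 : 0 < -f 1 / (8 * m) := div_pos (by linarith) (by positivity)
  refine ⟨Ω, hΩ, hJlt Ω hΩJ, fun N hN => hη2 N hN Ω hΩJ, fun G hG => ?_, fun n hn => ?_,
    fun n hn G hG => ?_⟩
  · have heq := hG.eqOn (hF Ω hΩJ) (h.continuous_potential (hJlt Ω hΩJ))
      (fun r _ => (h.potential_pos (hJlt Ω hΩJ) r).le) (hη2 m le_rfl Ω hΩJ)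
    rw [← hroot]
    simp only [dispersion]
    rw [heq (right_mem_Icc.2 zero_le_one)]
    congr 1
    refine intervalIntegral.integral_congr fun s hs => ?_
    rw [uIcc_of_le zero_le_one] at hs
    simp only [heq hs]
  · have := hgap2 n hn
    linarith
  · have hN : m ≤ n * m := Nat.le_mul_of_pos_left m (by lia)
    rw [h.dispersion_eq (hm.trans hN) _ hG.cont]
    have h1 := (abs_le.1 (hcorr _ hN _ hΩJ _ hG)).1
    have h2 := hgap2 n hn
    have h3 := mul_le_mul (hmain _ hN _ hΩJ _ hG)
      (by linarith : -f 1 / (8 * m) ≤ Ω - omegaHat f (n * m))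
      hb8.le (by have := hmain _ hN _ hΩJ _ hG; linarith)
    have h4 : 2 * (L + 2) * η / m < 1 / 4 * (-f 1 / (8 * m)) := by
      have e : 1 / 4 * (-f 1 / (8 * m)) = (-f 1 / 32) / m := by field_simp; ring
      rw [e]
      exact div_lt_div_of_pos_right (by linarith) hm0
    exact ne_of_gt (by linarith)

/-! ### Asymptotics: the smallness conditions hold for large `m`. -/

theorem eventually_rpow_neg_lt {p δ : ℝ} (hp : 0 < p) (hδ : 0 < δ) :
    ∀ᶠ m : ℕ in Filter.atTop, (m : ℝ) ^ (-p) < δ :=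
  ((tendsto_rpow_neg_atTop hp).comp tendsto_natCast_atTop_atTop).eventually (gt_mem_nhds hδ)

/-- The factor `log m / m` is traded for a pure power through `log x ≤ x^ε / ε`. -/
theorem pot_potential_le_rpow (h : RadialData f q c L) {ε : ℝ} (hε : 0 < ε) {m N : ℕ}
    (hm : 1 ≤ m) (hN : m ≤ N) {Ω : ℝ} (hΩ : mean f 1 + -f 1 / (4 * m) ≤ Ω) :
    pot N (potential f q Ω) 1
      ≤ 2 * L / c * ((1 + c / -f 1) ^ ε / ε) * (m : ℝ) ^ (-(1 - ε)) := by
  have hc := h.pos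
  have hL := h.L_pos
  have hb : 0 < -f 1 := neg_pos.2 h.neg
  have hm0 : (0 : ℝ) < m := by exact_mod_cast hm
  have hm1 : (1 : ℝ) ≤ m := by exact_mod_cast hm
  have hN' : (m : ℝ) ≤ N := by exact_mod_cast hN
  refine (h.pot_potential_le (by positivity) hΩ (hm.trans hN)).trans ?_
  have e1 : 1 + c / (4 * (-f 1 / (4 * m))) ≤ (1 + c / -f 1) * m := by
    have : c / (4 * (-f 1 / (4 * m))) = c / -f 1 * m := by
      have := h.neg.ne
      field_simp
    rw [this]
    linarith
  have e2 : Real.log (1 + c / (4 * (-f 1 / (4 * m)))) ≤ (1 + c / -f 1) ^ ε / ε * (m : ℝ) ^ ε := by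
    refine (Real.log_le_log (by positivity) e1).trans ?_
    refine (Real.log_le_rpow_div (by positivity) hε).trans (le_of_eq ?_)
    rw [Real.mul_rpow (by positivity) hm0.le]
    ring
  have e3 : (m : ℝ) ^ (-(1 - ε)) = (m : ℝ) ^ ε / m := by
    rw [show -(1 - ε) = ε - 1 by ring, Real.rpow_sub_one hm0.ne']
  calc 4 * L / c * Real.log (1 + c / (4 * (-f 1 / (4 * m)))) / (2 * N)
      ≤ 4 * L / c * ((1 + c / -f 1) ^ ε / ε * (m : ℝ) ^ ε) / (2 * m) :=
        div_le_div₀ (by positivity) (mul_le_mul_of_nonneg_left e2 (by positivity))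
          (by positivity) (by linarith)
    _ = _ := by
        rw [e3]
        field_simp
        ring

theorem exists_forall_dispersion_root (h : RadialData f q c L) {α : ℝ} (hα : α ∈ Ioo (1 : ℝ) 2) :
    ∃ m₀ : ℕ, 1 ≤ m₀ ∧ ∀ m : ℕ, m₀ ≤ m →
      ∃ Ω ∈ Ioo (omegaHat f m - (m : ℝ) ^ (-α)) (omegaHat f m), mean f 1 < Ω ∧
      (∀ N : ℕ, m ≤ N → pot N (potential f q Ω) 1 ≤ 1 / 2) ∧
      (∀ F, IsVolterraSol m (potential f q Ω) F → dispersion f m Ω F = 0) ∧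
      (∀ n : ℕ, 2 ≤ n → omegaHat f (n * m) < Ω) ∧
      (∀ n : ℕ, 2 ≤ n → ∀ F, IsVolterraSol (n * m) (potential f q Ω) F →
        dispersion f (n * m) Ω F ≠ 0) := by
  have hc := h.pos
  have hL := h.L_pos
  have hcL := h.le_L
  have hb : 0 < -f 1 := neg_pos.2 h.neg
  obtain ⟨hα1, hα2⟩ := hα
  -- With this `ε`, `2 - ε = α + ε`, so the correction, of order `m^{-(2-ε)}`, equals `m^{-α}` times
  -- the decaying factor `m^{-ε}`.
  set ε := (2 - α) / 2 with hε
  have hε0 : 0 < ε := by linarith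
  have hε1 : 0 < 1 - ε := by linarith
  set K := 2 * L / c * ((1 + c / -f 1) ^ ε / ε) with hK
  have hK0 : 0 < K := by positivity
  set ρ := 1 - c / (8 * L) with hρ
  have hρ1 : |ρ| < 1 := by
    have h1 : c / (8 * L) ≤ 1 := by
      rw [div_le_one (by positivity)]
      linarith
    have h2 : 0 < c / (8 * L) := by positivity
    rw [abs_lt]
    constructor <;> linarith
  -- The cube and the `12` come from `(m+1)² (m+2) ≤ 12 m³`.
  have hpow := (tendsto_pow_const_mul_const_pow_of_abs_lt_one 3 hρ1).eventually
    (gt_mem_nhds (by positivity : 0 < c ^ 2 / (2 * L * (32 * (1 + L) * 12))))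
  have hev := (eventually_rpow_neg_lt zero_lt_one (by positivity : 0 < -f 1 / (8 * L))).and <|
    (eventually_rpow_neg_lt (by linarith : 0 < α - 1) (by positivity : 0 < -f 1 / 16)).and <|
    (eventually_rpow_neg_lt zero_lt_one (by positivity : 0 < 1 / (-f 1 + L))).and <|
    (eventually_rpow_neg_lt zero_lt_one (by positivity : 0 < c / 16 / (-f 1 + L))).and <|
    (eventually_rpow_neg_lt hε1 (by positivity : 0 < 1 / 4 / K)).and <|
    (eventually_rpow_neg_lt hε1 (by positivity : 0 < -f 1 / (64 * (L + 2) * K))).and <|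
    (eventually_rpow_neg_lt hε0 (by positivity : 0 < 1 / (8 * (L + 2) * K))).and hpow
  obtain ⟨m₁, hm₁⟩ := Filter.eventually_atTop.1 hev
  refine ⟨max 1 m₁, le_max_left _ _, fun m hm => ?_⟩
  have hm1 : 1 ≤ m := (le_max_left _ _).trans hm
  obtain ⟨b1, b2, b3, b4, b5, b6, b7, b8⟩ := hm₁ m ((le_max_right _ _).trans hm)
  have hm0 : (0 : ℝ) < m := by exact_mod_cast hm1
  have hm1' : (1 : ℝ) ≤ m := by exact_mod_cast hm1
  have inv : (m : ℝ) ^ (-(1 : ℝ)) = 1 / m := by rw [Real.rpow_neg_one, one_div]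
  rw [inv] at b1 b3 b4
  have hsmall : -f 1 / (2 * m) + L / (2 * (m : ℝ) ^ 2) ≤ (-f 1 + L) * (1 / m) := by
    have h1 : -f 1 / (2 * m) ≤ -f 1 / m :=
      div_le_div_of_nonneg_left hb.le hm0 (by linarith)
    have h2 : L / (2 * (m : ℝ) ^ 2) ≤ L / m :=
      div_le_div_of_nonneg_left hL.le hm0 (by nlinarith)
    have e : (-f 1 + L) * (1 / m) = -f 1 / m + L / m := by ring
    linarith
  refine h.exists_dispersion_root hm1 (η := K * (m : ℝ) ^ (-(1 - ε))) (by positivity) ?_ ?_ ?_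
    (fun N hN Ω hΩ => h.pot_potential_le_rpow hε0 hm1 hN hΩ) ?_ ?_ ?_ ?_
  · have e1 : (m : ℝ) ^ (-α) = (m : ℝ) ^ (-(α - 1)) / m := by
      rw [show -α = -(α - 1) - 1 by ring, Real.rpow_sub_one hm0.ne']
    have e2 : L / (2 * (m : ℝ) ^ 2) = L * (1 / m) / 2 / m := by field_simp
    have e3 : -f 1 / (8 * m) = -f 1 / 8 / m := by field_simp
    rw [e1, e2, e3, ← add_div]
    refine div_le_div_of_nonneg_right ?_ hm0.le
    rw [lt_div_iff₀ (by positivity)] at b1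
    linarith
  · rw [lt_div_iff₀ (by positivity)] at b3
    linarith
  · rw [lt_div_iff₀ (by positivity)] at b4
    linarith
  · rw [lt_div_iff₀ (by positivity)] at b5
    linarith
  · rw [lt_div_iff₀ (by positivity)] at b6
    linarith
  · rw [lt_div_iff₀ (by positivity)] at b7
    have e : (m : ℝ) ^ (-(1 - ε)) / m = (m : ℝ) ^ (-ε) * (m : ℝ) ^ (-α) := by
      rw [← Real.rpow_add hm0, ← Real.rpow_sub_one hm0.ne']
      congr 1
      rw [hε]
      ring
    have e2 : 8 * (L + 2) * (K * (m : ℝ) ^ (-(1 - ε))) / m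
        = ((m : ℝ) ^ (-ε) * (8 * (L + 2) * K)) * (m : ℝ) ^ (-α) := by
      rw [mul_right_comm ((m : ℝ) ^ (-ε)), ← e]
      ring
    rw [e2]
    exact mul_lt_of_lt_one_left (by positivity) b7
  · have e : c ^ 2 / (32 * (1 + L) * (12 * (m : ℝ) ^ 3))
        ≤ c ^ 2 / (32 * (1 + L) * ((m : ℝ) + 1) ^ 2 * (m + 2)) := by
      refine div_le_div_of_nonneg_left (by positivity) (by positivity) ?_
      rw [mul_assoc]
      refine mul_le_mul_of_nonneg_left ?_ (by positivity)
      calc ((m : ℝ) + 1) ^ 2 * (m + 2) ≤ (2 * m) ^ 2 * (3 * m) :=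
            mul_le_mul (pow_le_pow_left₀ (by positivity) (by linarith) 2) (by linarith)
              (by positivity) (by positivity)
        _ = 12 * (m : ℝ) ^ 3 := by ring
    refine lt_of_lt_of_le ?_ e
    rw [lt_div_iff₀ (by positivity)] at b8 ⊢
    linarith

end RadialData

/-! ### From the profile to radial data and back. -/

/-- A profile is the restriction to `[0,1]` of radial data. -/
theorem IsProfile.exists_radialData {f₀ : ℝ → ℝ} (hf₀ : IsProfile f₀)
    (hneg : ∀ r ∈ Icc (0 : ℝ) 1, f₀ r < 0) :
    ∃ f q c L, RadialData f q c L ∧ EqOn f₀ f (Icc 0 1) ∧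
      ∀ r ∈ Ioc (0 : ℝ) 1, derivWithin f₀ (Icc 0 1) r = 2 * r * q r := by
  obtain ⟨⟨β, g, _, _, ⟨hg, _⟩, hfg⟩, c, hc, hinc⟩ := hf₀
  have hu := uniqueDiffOn_Icc (zero_lt_one (α := ℝ))
  have hp : ∀ r : ℝ, (max 0 (min r 1)) ^ 2 ∈ Icc (0 : ℝ) 1 := fun r =>
    ⟨sq_nonneg _, pow_le_one₀ (le_max_left _ _) (by simp)⟩
  have hpe : ∀ r ∈ Icc (0 : ℝ) 1, max 0 (min r 1) = r := fun r hr => by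
    rw [min_eq_left hr.2, max_eq_right hr.1]
  set g' := derivWithin g (Icc 0 1) with hg'
  have cg' : ContinuousOn g' (Icc 0 1) := hg.continuousOn_derivWithin hu (by norm_num)
  have dg : ∀ x ∈ Icc (0 : ℝ) 1, HasDerivWithinAt g (g' x) (Icc 0 1) x := fun x hx =>
    (hg.differentiableOn (by norm_num) x hx).hasDerivWithinAt
  have hmaps : MapsTo (fun r : ℝ => r ^ 2) (Icc 0 1) (Icc 0 1) := fun r hr =>
    ⟨sq_nonneg _, pow_le_one₀ hr.1 hr.2⟩
  have hd : ∀ r ∈ Icc (0 : ℝ) 1, derivWithin f₀ (Icc 0 1) r = 2 * r * g' (r ^ 2) := by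
    intro r hr
    have h1 : HasDerivWithinAt (g ∘ fun r : ℝ => r ^ 2) (g' (r ^ 2) * (2 * r)) (Icc 0 1) r := by
      refine HasDerivWithinAt.comp r (dg _ (hmaps hr)) ?_ hmaps
      simpa using (hasDerivAt_pow 2 r).hasDerivWithinAt
    rw [derivWithin_congr (f := g ∘ fun r : ℝ => r ^ 2) (fun x hx => hfg x hx) (hfg r hr),
      h1.derivWithin (hu r hr)]
    ring
  have hlow' : ∀ x ∈ Ioc (0 : ℝ) 1, c / 2 ≤ g' x := by
    intro x hx
    have hs : √x ∈ Ioc (0 : ℝ) 1 := ⟨Real.sqrt_pos.2 hx.1, Real.sqrt_le_one.2 hx.2⟩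
    have h1 := hinc _ hs
    rw [hd _ (Ioc_subset_Icc_self hs), Real.sq_sqrt hx.1.le, mul_right_comm,
      mul_div_cancel_right₀ _ hs.1.ne'] at h1
    linarith
  -- The bound reaches `x = 0`, where the hypothesis says nothing, by continuity of `g'`.
  have hlow : ∀ x ∈ Icc (0 : ℝ) 1, c / 2 ≤ g' x := by
    intro x hx
    have hcl : closure (Ioc (0 : ℝ) 1) = Icc 0 1 := closure_Ioc zero_ne_one
    rw [← hcl] at hx cg'
    exact le_on_closure hlow' continuousOn_const cg' hx
  obtain ⟨L, hL⟩ := isCompact_Icc.exists_bound_of_continuousOn cg'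
  have hhigh : ∀ x ∈ Icc (0 : ℝ) 1, g' x ≤ L := fun x hx => (le_abs_self _).trans (hL x hx)
  have hdi : ∀ x ∈ interior (Icc (0 : ℝ) 1), deriv g x = g' x := fun x hx =>
    ((dg x (interior_subset hx)).hasDerivAt (mem_interior_iff_mem_nhds.1 hx)).deriv
  have hdiff : DifferentiableOn ℝ g (interior (Icc 0 1)) :=
    (hg.differentiableOn (by norm_num)).mono interior_subset
  have hinc1 : ∀ x ∈ Icc (0 : ℝ) 1, ∀ y ∈ Icc (0 : ℝ) 1, x ≤ y → c / 2 * (y - x) ≤ g y - g x :=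
    (convex_Icc 0 1).mul_sub_le_image_sub_of_le_deriv hg.continuousOn hdiff fun x hx => by
      rw [hdi x hx]
      exact hlow x (interior_subset hx)
  have hinc2 : ∀ x ∈ Icc (0 : ℝ) 1, ∀ y ∈ Icc (0 : ℝ) 1, x ≤ y → g y - g x ≤ L * (y - x) :=
    (convex_Icc 0 1).image_sub_le_mul_sub_of_deriv_le hg.continuousOn hdiff fun x hx => by
      rw [hdi x hx]
      exact hhigh x (interior_subset hx)
  -- Clamping `r` to `[0,1]` yields functions continuous on all of `ℝ`, with `q` bounded everywhere.
  refine ⟨fun r => g ((max 0 (min r 1)) ^ 2), fun r => g' ((max 0 (min r 1)) ^ 2), c / 2, L,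
    ⟨hg.continuousOn.comp_continuous (by fun_prop) hp, cg'.comp_continuous (by fun_prop) hp,
      by positivity, fun r => hlow _ (hp r), fun r => hhigh _ (hp r), fun s t hs hst ht => ?_,
      fun s t hs hst ht => ?_, ?_⟩, fun r hr => ?_, fun r hr => ?_⟩
  · simp only [hpe s ⟨hs, hst.trans ht⟩, hpe t ⟨hs.trans hst, ht⟩]
    exact hinc1 _ (hmaps ⟨hs, hst.trans ht⟩) _ (hmaps ⟨hs.trans hst, ht⟩) (pow_le_pow_left₀ hs hst 2)
  · simp only [hpe s ⟨hs, hst.trans ht⟩, hpe t ⟨hs.trans hst, ht⟩]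
    exact hinc2 _ (hmaps ⟨hs, hst.trans ht⟩) _ (hmaps ⟨hs.trans hst, ht⟩) (pow_le_pow_left₀ hs hst 2)
  · have h1 : (1 : ℝ) ∈ Icc (0 : ℝ) 1 := by simp
    simp only [hpe 1 h1, ← hfg 1 h1]
    exact hneg 1 h1
  · simp only [hpe r hr, hfg r hr]
  · simp only [hpe r (Ioc_subset_Icc_self hr), hd r (Ioc_subset_Icc_self hr)]

section Transfer

variable {f₀ f q : ℝ → ℝ} {c L : ℝ}

theorem mean_eq_of_eqOn (he : EqOn f₀ f (Icc 0 1)) {r : ℝ} (hr : r ∈ Icc (0 : ℝ) 1) :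
    ∫ s in (0 : ℝ)..1, s * f₀ (s * r) = mean f r := by
  rw [mean_of_mem hr]
  refine intervalIntegral.integral_congr fun s hs => ?_
  rw [uIcc_of_le zero_le_one] at hs
  simp only [he (⟨mul_nonneg hs.1 hr.1, mul_le_one₀ hs.2 hr.1 hr.2⟩ : s * r ∈ Icc (0 : ℝ) 1)]

theorem kappa₂_eq_mean (h : RadialData f q c L) (he : EqOn f₀ f (Icc 0 1)) :
    kappa₂ f₀ = mean f 1 := by
  have e : ∀ r : Icc (0 : ℝ) 1, ∫ s in (0 : ℝ)..1, s * f₀ (r * s) = mean f r := fun r => by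
    rw [← mean_eq_of_eqOn he r.2]
    simp only [mul_comm]
  simp only [kappa₂, e]
  refine le_antisymm (ciSup_le fun r => h.mean_le r) ?_
  exact le_ciSup (f := fun r : Icc (0 : ℝ) 1 => mean f r)
    ⟨mean f 1, by rintro _ ⟨r, rfl⟩; exact h.mean_le r⟩ ⟨1, by simp⟩

theorem omegaHat_congr (he : EqOn f₀ f (Icc 0 1)) (n : ℕ) : omegaHat f₀ n = omegaHat f n := by
  unfold omegaHat
  congr 1
  · refine intervalIntegral.integral_congr fun s hs => ?_
    rw [uIcc_of_le zero_le_one] at hs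
    simp only [he hs]
  · congr 1
    refine intervalIntegral.integral_congr fun s hs => ?_
    rw [uIcc_of_le zero_le_one] at hs
    simp only [he hs]

theorem sigma_mul_nu (h : RadialData f q c L) (he : EqOn f₀ f (Icc 0 1))
    (hd : ∀ r ∈ Ioc (0 : ℝ) 1, derivWithin f₀ (Icc 0 1) r = 2 * r * q r) {Ω : ℝ}
    (hΩ : mean f 1 < Ω) {r : ℝ} (hr : r ∈ Ioo (0 : ℝ) 1) :
    sigma f₀ Ω * nu f₀ Ω r = potential f q Ω r := by
  have hσ : sigma f₀ Ω * sigma f₀ Ω = 1 := by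
    have : kappa₂ f₀ < Ω := by rwa [kappa₂_eq_mean h he]
    unfold sigma
    -- Either nonzero value of the sign squares to `1`, so `κ₁` and `κ₂` need not be compared.
    split_ifs <;> norm_num
  have hr0 := hr.1.ne'
  rw [nu, ← mul_assoc, hσ, one_mul, mu0, hd r (Ioo_subset_Ioc_self hr),
    mean_eq_of_eqOn he (Ioo_subset_Icc_self hr), potential, mul_right_comm, mul_comm r,
    mul_div_mul_right _ _ hr0]

theorem zeta_eq_dispersion (he : EqOn f₀ f (Icc 0 1)) {n : ℕ} {Ω : ℝ} {F : ℝ → ℝ}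
    (hF : EqOn (slSol f₀ n Ω) F (Icc 0 1)) : zeta f₀ n Ω = dispersion f n Ω F := by
  have e : ∫ s in (0 : ℝ)..1, s * f₀ s = mean f 1 := by
    rw [← mean_eq_of_eqOn he (by simp)]
    simp only [mul_one]
  rw [zeta, dispersion, e, hF (right_mem_Icc.2 zero_le_one)]
  congr 1
  refine intervalIntegral.integral_congr fun s hs => ?_
  rw [uIcc_of_le zero_le_one] at hs
  simp only [he hs, hF hs]

end Transfer

end

end RotatingVortex

theorem proposition4p8 (f₀ : ℝ → ℝ) (hf₀ : RotatingVortex.IsProfile f₀)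
    (hneg : ∀ r ∈ Set.Icc (0 : ℝ) 1, f₀ r < 0)
    (α : ℝ) (hα : α ∈ Set.Ioo (1 : ℝ) 2) :
    ∃ m₀ : ℕ, 1 ≤ m₀ ∧ ∀ m : ℕ, m₀ ≤ m →
      ∃ Ω : ℝ,
        Ω ∈ Set.Ioo (RotatingVortex.omegaHat f₀ m - (m : ℝ) ^ (-α))
          (RotatingVortex.omegaHat f₀ m) ∧
        -- `ζ_{nm}` is genuinely defined at `Ω`
        RotatingVortex.kappa₂ f₀ < Ω ∧
        (∀ n : ℕ, 1 ≤ n → RotatingVortex.HasUniqueSturmLiouvilleSol f₀ (n * m) Ω) ∧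
        RotatingVortex.zeta f₀ m Ω = 0 ∧
        (∀ n : ℕ, 1 ≤ n → Ω ≠ RotatingVortex.omegaHat f₀ (n * m)) ∧
        (∀ n : ℕ, 2 ≤ n → RotatingVortex.zeta f₀ (n * m) Ω ≠ 0) := by
  open RotatingVortex in
  obtain ⟨f, q, c, L, h, he, hd⟩ := hf₀.exists_radialData hneg
  obtain ⟨m₀, hm₀, H⟩ := h.exists_forall_dispersion_root hα
  refine ⟨m₀, hm₀, fun m hm => ?_⟩
  obtain ⟨Ω, hΩ, hκ, hpot, hroot, hgap, hne⟩ := H m hm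
  have hM := h.continuous_potential hκ
  have hM0 : ∀ r ∈ Set.Icc (0 : ℝ) 1, 0 ≤ potential f q Ω r := fun r _ =>
    (h.potential_pos hκ r).le
  have hsol : ∀ N, m ≤ N → ∃ F, IsVolterraSol N (potential f q Ω) F ∧
      HasUniqueSturmLiouvilleSol f₀ N Ω ∧ zeta f₀ N Ω = dispersion f N Ω F := fun N hN => by
    obtain ⟨F, hF⟩ := exists_isVolterraSol hM hM0 (hpot N hN)
    obtain ⟨hu, hs⟩ := hF.hasUnique hM hM0 (hpot N hN) fun r hr => sigma_mul_nu h he hd hκ hr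
    exact ⟨F, hF, hu, zeta_eq_dispersion he hs⟩
  have hle : ∀ n : ℕ, 1 ≤ n → m ≤ n * m := fun n hn => Nat.le_mul_of_pos_left m hn
  refine ⟨Ω, ?_, ?_, fun n hn => ?_, ?_, fun n hn => ?_, fun n hn => ?_⟩
  · rwa [omegaHat_congr he]
  · rwa [kappa₂_eq_mean h he]
  · obtain ⟨F, -, hu, -⟩ := hsol _ (hle n hn)
    exact hu
  · obtain ⟨F, hF, -, hz⟩ := hsol m le_rfl
    rw [hz, hroot F hF]
  · rw [omegaHat_congr he]
    -- The root is strictly below `Ω̂_m` but strictly above every `Ω̂_{nm}` with `n ≥ 2`.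
    rcases hn.eq_or_lt with rfl | hn2
    · rw [one_mul]
      exact hΩ.2.ne
    · exact (hgap n hn2).ne'
  · obtain ⟨F, hF, -, hz⟩ := hsol _ (hle n (by lia))
    rw [hz]
    exact hne n hn F hF
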